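/- For $r>0$ let $\theta(r)=2\arcsin\frac{r}{1+r}$, and let $\mathrm{Conf}(12)[r]$ be the space of labelled $12$-tuples $(u_1,\dots,u_{12})$ of points of the unit sphere $S^2\subset\mathbb R^3$ with pairwise angular distance at least $\theta(r)$; equivalently, of $12$ labelled balls of radius $r$ with disjoint interiors that touch the central unit ball, at the points $u_i$. A *labelled DOD configuration* is a labelling of the $12$ vertices of a regular icosahedron inscribed in $S^2$. *The move $M_5$.* Rotate a labelled DOD configuration so that two opposite balls $N,S$ touch the central ball at the poles; let $U_1,\dots,U_5$ and $V_1,\dots,V_5$ be the balls around $N$ and around $S$. For balls of radius $r$ the move has three phases: (1) the $U_j$ move along their meridians towards $N$ until they touch $N$, and the $V_j$ likewise towards $S$; (2) the six northern balls are rotated rigidly by $2\pi/5$ about the polar axis; (3) phase (1) is reversed. The result is the DOD configuration at the same $12$ touching points in which the labels of the five neighbours of $N$ have been permuted cyclically. For $r\le 1$ the balls do not overlap during the move. A *modified $M_5$-move with balls of radius $r$* is a continuous motion in $\mathrm{Conf}(12)[r]$ whose first and third phases are those of the $M_5$-move with balls of radius $r$, whose second phase is arbitrary, and which is homotopic, relative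 to its end points and through motions of $12$ distinct labelled points of $S^2$, to the original move $M_5$ with unit balls. **Theorem.** There is $r_1>1$ such that for every $r$ with $0<r\le r_1$ the following hold. 1. Every move $M_5$ (for every labelled DOD configuration and every choice of the ball $N$) can be modified so as to be performed with balls of radius $r$: there is a corresponding modified $M_5$-move with balls of radius $r$. 2. For every labelled DOD configuration $X$, the permutations $\sigma$ of the labels for which a finite composition of modified $M_5$-moves with balls of radius $r$ leads from $X$ to the relabelled configuration $X\circ\sigma$ (at the same $12$ touching points) are exactly the even ones, i.e. they form the alternating group $A_{12}$. 3. Consequently every labelled DOD configuration $X$ can be continuously deformed inside $\mathrm{Conf}(12)[r]$ to any labelled DOD configuration whose labels are an even permutation of those of $X$, that is, to $R(X\circ\sigma)$ for every $\sigma\in A_{12}$ and every $R\in SO(3)$. -/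

import Mathlib

/-- Three-dimensional Euclidean space. -/
abbrev E3 : Type := EuclideanSpace ℝ (Fin 3)

/-- The unit sphere in three-dimensional Euclidean space: the surface of the central ball. -/
abbrev S2 : Type := Metric.sphere (0 : E3) 1

/-- The angular diameter `θ` of the spherical cap that a ball of radius `r` touching the central
unit ball projects to; it satisfies `sin (θ / 2) = r / (1 + r)`. Two balls of radius `r` touch
exactly when the angular distance of their touching points is this angle. -/
noncomputable def contactAngle (r : ℝ) : ℝ := 2 * Real.arcsin (r / (1 + r))

/-- The configuration space `Conf(N)` of `N` distinct labelled points on the unit sphere. -/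
def conf (N : ℕ) : Set (Fin N → S2) := {U | Function.Injective U}

/-- The constrained configuration space `Conf(N)[r]`: touching points of `N` labelled balls of
radius `r` with disjoint interiors that all touch the central unit ball. -/
def confRadius (N : ℕ) (r : ℝ) : Set (Fin N → S2) :=
  {U | ∀ i j, i ≠ j → contactAngle r ≤ InnerProductGeometry.angle (U i : E3) (U j : E3)}

/-- The point of the unit sphere with polar distance `p` (from the north pole) and longitude
`a`. -/
noncomputable def spherical (p a : ℝ) : S2 :=
  ⟨!₂[Real.sin p * Real.cos a, Real.sin p * Real.sin a, Real.cos p], by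
    rw [mem_sphere_zero_iff_norm, EuclideanSpace.norm_eq, Real.sqrt_eq_one]
    simp only [Fin.sum_univ_three, Real.norm_eq_abs, sq_abs,
      Matrix.cons_val_zero, Matrix.cons_val_one, Matrix.cons_val]
    nlinarith [Real.sin_sq_add_cos_sq p, Real.sin_sq_add_cos_sq a]⟩

/-- The twelve points formed by the north pole `N` (label `0`), five northern points
`U₁, …, U₅` (labels `1, …, 5`) at distance `p` from the north pole and longitudes
`a + (j - 1) 2π/5`, five southern points `V₁, …, V₅` (labels `6, …, 10`) at distance `p` from the
south pole and longitudes `π/5 + (j - 1) 2π/5`, and the south pole `S` (label `11`). -/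
noncomputable def rings (p a : ℝ) (i : Fin 12) : S2 :=
  if i.val = 0 then spherical 0 0
  else if i.val ≤ 5 then spherical p (a + ((i.val : ℝ) - 1) * (2 * Real.pi / 5))
  else if i.val ≤ 10 then
    spherical (Real.pi - p) (Real.pi / 5 + ((i.val : ℝ) - 6) * (2 * Real.pi / 5))
  else spherical Real.pi 0

/-- The standard labelled `DOD` configuration: the vertices of a regular icosahedron with two
opposite vertices at the poles; neighbouring vertices have angular distance `arctan 2`. -/
noncomputable def dod : Fin 12 → S2 := rings (Real.arctan 2) 0

/-- `R` belongs to `SO(3)`. -/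
def IsRotation (R : E3 ≃ₗᵢ[ℝ] E3) : Prop :=
  LinearMap.det (R.toLinearEquiv : E3 →ₗ[ℝ] E3) = 1

/-- The action of an isometry on configurations of points of the unit sphere. -/
noncomputable def rotateConf {N : ℕ} (R : E3 ≃ₗᵢ[ℝ] E3) (U : Fin N → S2) : Fin N → S2 :=
  fun i => ⟨R (U i : E3), by simp⟩

/-- Labelled `DOD` configurations: the rotated and relabelled copies of `dod`. -/
def IsDOD (X : Fin 12 → S2) : Prop :=
  ∃ (R : E3 ≃ₗᵢ[ℝ] E3) (π : Equiv.Perm (Fin 12)), IsRotation R ∧ X = rotateConf R (dod ∘ π)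

/-- The unmodified `M₅`-move with balls of radius `r`, in standard position and at time
`t ∈ [0, 1]`.
First phase, `0 ≤ t ≤ 1/3`: starting from `dod`, the `U_j` move along their meridians
towards `N`, and the `V_j` along theirs towards `S`, until they touch `N` or `S` respectively.
Second phase, `1/3 ≤ t ≤ 2/3`: the northern six balls are rotated rigidly about the
polar axis by `2π/5`.
Third phase, `2/3 ≤ t ≤ 1`: the meridional motions of the first phase are reversed. -/
noncomputable def rigidM5 (r t : ℝ) : Fin 12 → S2 :=
  let s : ℝ := min 1 (min (3 * t) (3 * (1 - t)))
  rings ((1 - s) * Real.arctan 2 + s * contactAngle r)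
    (max 0 (min 1 (3 * t - 1)) * (2 * Real.pi / 5))

/-- `γ` and `δ` are homotopic, relative to their end points, as motions of twelve distinct
labelled points on the sphere. -/
def HomotopicMotions (γ δ : unitInterval → Fin 12 → S2) : Prop :=
  ∃ H : unitInterval × unitInterval → Fin 12 → S2, Continuous H ∧
    (∀ s t, H (s, t) ∈ conf 12) ∧
    (∀ t, H (0, t) = γ t) ∧ (∀ t, H (1, t) = δ t) ∧
    (∀ s, H (s, 0) = γ 0) ∧ (∀ s, H (s, 1) = γ 1)

/-- `γ` is a modified `M₅`-move with balls of radius `r`, in the frame given by the rotation `R`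
and the labelling `π`; it starts at the configuration `rotateConf R (dod ∘ π)`, and the ball
`N` that is surrounded by the five circulating balls is the one labelled `π⁻¹ 0`.
It is a motion in `Conf(12)[r]`; its first and third phases are those of the `M₅`-move, only the
second phase is modified; and it is still a deformation of the original move for unit balls,
through motions of twelve distinct points. -/
def IsModifiedM5 (r : ℝ) (R : E3 ≃ₗᵢ[ℝ] E3) (π : Equiv.Perm (Fin 12))
    (γ : unitInterval → Fin 12 → S2) : Prop :=
  Continuous γ ∧ (∀ t, γ t ∈ confRadius 12 r) ∧
  (∀ t : unitInterval, (t : ℝ) ≤ 1 / 3 ∨ 2 / 3 ≤ (t : ℝ) →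
    γ t = rotateConf R (rigidM5 r t ∘ π)) ∧
  HomotopicMotions γ (fun t => rotateConf R (rigidM5 1 t ∘ π))

/-- Some modified `M₅`-move with balls of radius `r` leads from `X` to `Y`. -/
def M5Step (r : ℝ) (X Y : Fin 12 → S2) : Prop :=
  ∃ (R : E3 ≃ₗᵢ[ℝ] E3) (π : Equiv.Perm (Fin 12)) (γ : unitInterval → Fin 12 → S2),
    IsRotation R ∧ IsModifiedM5 r R π γ ∧ γ 0 = X ∧ γ 1 = Y

/-!
The proof has a geometric and a combinatorial part.

**Moving larger balls.** For unit balls the only obstacle to the second phase is that five balls of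
the northern ring touch five southern balls at the moment when they have the same longitudes. In a
ring of touching unit balls there is room to let the five pairs pass at different times. When only
the ball `i` passes, all unit balls separate to first order under the following deformation: the
southern ring goes up with velocity `1`, the ball `i` goes up faster, the pole `N` moves away from
it faster still, and the other four northern balls go down fast enough to escape from `N`. Such
deformations form the set `separating`; the condition on the velocities is convex, so that a path
in this set from the initial to the rotated ring is composed of line segments
(`joinedIn_separating`). Along this compact path, a small common deformation time separates all
balls strictly (`eventually_separated`), which leaves room for a radius `r₁ > 1`
(`exists_radius`). All configurations on the way belong to a family of twelve distinct points with
a convex set of parameters (`admissible`, `place_mem_conf`), hence the modified move is homotopic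
to the rigid one by a straight line in the parameters (`exists_isModifiedM5`).

**Permutations.** The move permutes the neighbours of `N` by a five-cycle, so that compositions
give even permutations only. Conversely, the realized relabellings form a group that contains the
five-cycles around all twelve vertices of the icosahedron, since rotational symmetries amount to
changes of frame (`conj_mem_realizedSubgroup`). This group is doubly transitive and contains a
three-cycle, and Jordan's theorem shows that it contains the alternating group
(`alternatingGroup_le_of_ringShift_mem`). The last assertion follows because the rotation group is
path-connected (`joinedIn_rotateConf`): a rotation is a product of an even number of reflections,
and any two reflections are joined by a path of reflections.
-/

open Filter Topology

/-! ### Contact angles and spherical coordinates -/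

theorem contactAngle_mem {r : ℝ} (hr : 0 < r) : contactAngle r ∈ Set.Ioo 0 Real.pi := by
  have h0 : 0 < r / (1 + r) := by positivity
  have h1 : r / (1 + r) < 1 := by rw [div_lt_one (by positivity)]; linarith
  unfold contactAngle
  constructor
  · have := Real.arcsin_pos.2 h0
    linarith
  · have := Real.arcsin_lt_pi_div_two.2 h1
    linarith

theorem contactAngle_one : contactAngle 1 = Real.pi / 3 := by
  have : Real.arcsin (1 / (1 + 1)) = Real.pi / 6 := by
    rw [show (1 / (1 + 1) : ℝ) = Real.sin (Real.pi / 6) by rw [Real.sin_pi_div_six]; norm_num]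
    apply Real.arcsin_sin <;> linarith [Real.pi_pos]
  rw [contactAngle, this]; ring

theorem contactAngle_mono {r r' : ℝ} (hr : 0 < r) (h : r ≤ r') :
    contactAngle r ≤ contactAngle r' := by
  unfold contactAngle
  have : r / (1 + r) ≤ r' / (1 + r') := by
    rw [div_le_div_iff₀ (by positivity) (by linarith)]; nlinarith
  linarith [Real.monotone_arcsin this]

theorem continuousAt_contactAngle_one : ContinuousAt contactAngle 1 := by
  unfold contactAngle
  refine ContinuousAt.mul continuousAt_const (Real.continuous_arcsin.continuousAt.comp ?_)
  exact ContinuousAt.div continuousAt_id (by fun_prop) (by norm_num)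

theorem mem_confRadius_iff {N : ℕ} {r : ℝ} (hr : 0 < r) {U : Fin N → S2} :
    U ∈ confRadius N r ↔
      ∀ i j, i ≠ j → inner ℝ (U i : E3) (U j : E3) ≤ Real.cos (contactAngle r) := by
  refine forall₃_congr fun i j _ => ?_
  have hi : ‖(U i : E3)‖ = 1 := by simp
  have hj : ‖(U j : E3)‖ = 1 := by simp
  have hc := InnerProductGeometry.cos_angle (U i : E3) (U j : E3)
  rw [hi, hj, mul_one, div_one] at hc
  rw [← hc]
  have := contactAngle_mem hr
  exact (Real.strictAntiOn_cos.le_iff_ge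
    ⟨InnerProductGeometry.angle_nonneg _ _, InnerProductGeometry.angle_le_pi _ _⟩
    ⟨this.1.le, this.2.le⟩).symm

theorem confRadius_anti {N : ℕ} {r r' : ℝ} (hr : 0 < r) (h : r ≤ r') :
    confRadius N r' ⊆ confRadius N r :=
  fun _ hU i j hij => (contactAngle_mono hr h).trans (hU i j hij)

theorem inner_spherical (p a q b : ℝ) :
    inner ℝ (spherical p a : E3) (spherical q b : E3) =
      Real.sin p * Real.sin q * Real.cos (a - b) + Real.cos p * Real.cos q := by
  simp only [spherical, EuclideanSpace.inner_eq_star_dotProduct, Real.cos_sub]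
  simp [Matrix.vecHead, Matrix.vecTail]
  ring

/-- The point of the unit sphere in the direction of `(x, y, 1)`: gnomonic coordinates around the
north pole. -/
noncomputable def gnomonic (x y : ℝ) : S2 :=
  ⟨(1 / √(1 + x ^ 2 + y ^ 2)) • !₂[x, y, 1], by
    have h : 0 < 1 + x ^ 2 + y ^ 2 := by positivity
    rw [mem_sphere_zero_iff_norm, norm_smul, EuclideanSpace.norm_eq]
    simp only [Fin.sum_univ_three, Real.norm_eq_abs, sq_abs,
      Matrix.cons_val_zero, Matrix.cons_val_one, Matrix.cons_val]
    rw [show x ^ 2 + y ^ 2 + 1 ^ 2 = 1 + x ^ 2 + y ^ 2 by ring, abs_of_nonneg (by positivity)]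
    field_simp⟩

theorem inner_gnomonic_spherical (x y p a : ℝ) :
    inner ℝ (gnomonic x y : E3) (spherical p a : E3) =
      (Real.sin p * (x * Real.cos a + y * Real.sin a) + Real.cos p) / √(1 + x ^ 2 + y ^ 2) := by
  simp only [spherical, gnomonic, EuclideanSpace.inner_eq_star_dotProduct]
  simp [Matrix.vecHead, Matrix.vecTail]
  ring

theorem spherical_zero (a : ℝ) : spherical 0 a = gnomonic 0 0 := by
  ext i; fin_cases i <;> simp [spherical, gnomonic]

theorem spherical_pi (a b : ℝ) : spherical Real.pi a = spherical Real.pi b := by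
  ext i; fin_cases i <;> simp [spherical]

theorem continuous_spherical : Continuous fun z : ℝ × ℝ => spherical z.1 z.2 := by
  unfold spherical
  refine Continuous.subtype_mk ?_ _
  refine (PiLp.continuous_toLp 2 _).comp (continuous_pi fun i => ?_)
  fin_cases i <;> simp <;> fun_prop

theorem continuous_gnomonic : Continuous fun z : ℝ × ℝ => gnomonic z.1 z.2 := by
  unfold gnomonic
  have h1 : Continuous fun z : ℝ × ℝ => 1 / √(1 + z.1 ^ 2 + z.2 ^ 2) :=
    Continuous.div continuous_const (by fun_prop) fun z => by positivity
  refine Continuous.subtype_mk (h1.smul ?_) _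
  · refine (PiLp.continuous_toLp 2 _).comp (continuous_pi fun i => ?_)
    fin_cases i <;> simp <;> fun_prop

/-! ### The regular pentagon -/

theorem cos_two_pi_div_five : Real.cos (2 * Real.pi / 5) = (√5 - 1) / 4 := by
  rw [mul_div_assoc, Real.cos_two_mul, Real.cos_pi_div_five]
  have : √5 ^ 2 = 5 := Real.sq_sqrt (by norm_num)
  nlinarith

theorem cos_four_pi_div_five : Real.cos (2 * (2 * Real.pi / 5)) = -(1 + √5) / 4 := by
  rw [Real.cos_two_mul, cos_two_pi_div_five]
  have : √5 ^ 2 = 5 := Real.sq_sqrt (by norm_num)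
  nlinarith

theorem sqrt_five_mem : √5 ∈ Set.Ioo (223 / 100 : ℝ) (224 / 100) := by
  constructor
  · exact Real.lt_sqrt_of_sq_lt (by norm_num)
  · rw [Real.sqrt_lt' (by norm_num)]; norm_num

theorem cos_mul_two_pi_div_five_add (m : ℤ) (x : ℝ) :
    Real.cos (m * (2 * Real.pi / 5) + x) =
      Real.cos ((m % 5 : ℤ) * (2 * Real.pi / 5) + x) := by
  have h : (m : ℝ) = (m % 5 : ℤ) + 5 * (m / 5 : ℤ) := by
    exact_mod_cast (Int.emod_add_mul_ediv m 5).symm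
  rw [← Real.cos_add_int_mul_two_pi ((m % 5 : ℤ) * (2 * Real.pi / 5) + x) (m / 5), h]
  congr 1; ring

theorem cos_mul_two_pi_div_five_le {m : ℤ} (hm : ¬ (5 : ℤ) ∣ m) :
    Real.cos (m * (2 * Real.pi / 5)) ≤ (√5 - 1) / 4 := by
  have h := cos_mul_two_pi_div_five_add m 0
  rw [add_zero, add_zero] at h
  rw [h]
  have h5 := sqrt_five_mem
  have h1 : Real.cos (1 * (2 * Real.pi / 5)) = (√5 - 1) / 4 := by
    rw [one_mul, cos_two_pi_div_five]
  have h2 := cos_four_pi_div_five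
  have h0 : m % 5 = 1 ∨ m % 5 = 2 ∨ m % 5 = 3 ∨ m % 5 = 4 := by omega
  rcases h0 with h | h | h | h <;> rw [h] <;> push_cast
  · exact h1.le
  · rw [h2]; linarith [h5.1]
  · rw [← Real.cos_two_pi_sub, show 2 * Real.pi - 3 * (2 * Real.pi / 5) = 2 * (2 * Real.pi / 5) by
      ring, h2]; linarith [h5.1]
  · rw [← Real.cos_two_pi_sub, show 2 * Real.pi - 4 * (2 * Real.pi / 5) = 1 * (2 * Real.pi / 5) by
      ring, h1]

theorem cos_mul_two_pi_div_five_sub_le (m : ℤ) :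
    Real.cos (m * (2 * Real.pi / 5) - Real.pi / 5) ≤ (1 + √5) / 4 := by
  rw [sub_eq_add_neg, cos_mul_two_pi_div_five_add]
  have h5 := sqrt_five_mem
  have h1 := Real.cos_pi_div_five
  have h0 : m % 5 = 0 ∨ m % 5 = 1 ∨ m % 5 = 2 ∨ m % 5 = 3 ∨ m % 5 = 4 := by omega
  have hpi := Real.pi_pos
  rcases h0 with h | h | h | h | h <;> rw [h] <;> push_cast
  · rw [zero_mul, zero_add, Real.cos_neg, h1]
  · rw [show 1 * (2 * Real.pi / 5) + -(Real.pi / 5) = Real.pi / 5 by ring, h1]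
  · refine (Real.cos_nonpos_of_pi_div_two_le_of_le ?_ ?_).trans (by linarith [h5.1]) <;> linarith
  · refine (Real.cos_nonpos_of_pi_div_two_le_of_le ?_ ?_).trans (by linarith [h5.1]) <;> linarith
  · refine (Real.cos_nonpos_of_pi_div_two_le_of_le ?_ ?_).trans (by linarith [h5.1]) <;> linarith

/-- Two directions that deviate by less than a fifth of a turn from different directions of a
regular pentagon are different. -/
theorem cos_mul_two_pi_div_five_add_lt_one {m : ℤ} {x : ℝ} (hm : |m| < 5) (h0 : m = 0 → x ≠ 0)
    (hx : |x| < 2 * Real.pi / 5) : Real.cos (m * (2 * Real.pi / 5) + x) < 1 := by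
  refine lt_of_le_of_ne (Real.cos_le_one _) fun h => ?_
  obtain ⟨n, hn⟩ := (Real.cos_eq_one_iff _).1 h
  have hpi := Real.pi_pos
  rw [abs_lt] at hx hm
  have h1 : x = ((5 * n - m : ℤ) : ℝ) * (2 * Real.pi / 5) := by push_cast; linarith
  have h2 : ((5 * n - m : ℤ) : ℝ) < 1 := by
    by_contra! hc
    nlinarith
  have h3 : (-1 : ℝ) < ((5 * n - m : ℤ) : ℝ) := by
    by_contra! hc
    nlinarith
  have h2' : 5 * n - m < 1 := by exact_mod_cast h2
  have h3' : -1 < 5 * n - m := by exact_mod_cast h3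
  have h4 : 5 * n - m = 0 := by omega
  have h5 : m = 0 := by omega
  refine h0 h5 ?_
  rw [h1, h4]; simp

/-! ### Two poles and two deformed rings -/

/-- The label of the `k`-th point of the northern ring. -/
def northLabel (k : Fin 5) : Fin 12 := ⟨k + 1, by omega⟩

/-- The label of the `k`-th point of the southern ring. -/
def southLabel (k : Fin 5) : Fin 12 := ⟨k + 6, by omega⟩

theorem label_cases (i : Fin 12) :
    i = 0 ∨ (∃ k, i = northLabel k) ∨ (∃ k, i = southLabel k) ∨ i = 11 := by
  revert i; decide

/-- Parameters `(x, y, p, s, q)` of a family of twelve points: gnomonic coordinates `x, y` of the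
point near the north pole, polar distances `p k` and longitudes `s k + k * (2π/5)` of a northern
ring, and the distance `q` of a fixed regular southern ring from the south pole. -/
abbrev RingParam : Type := ℝ × ℝ × (Fin 5 → ℝ) × (Fin 5 → ℝ) × ℝ

/-- The `k`-th point of the northern ring. -/
noncomputable def northPoint (c : RingParam) (k : Fin 5) : S2 :=
  spherical (c.2.2.1 k) (c.2.2.2.1 k + (k : ℝ) * (2 * Real.pi / 5))

/-- The `k`-th point of the southern ring. -/
noncomputable def southPoint (c : RingParam) (k : Fin 5) : S2 :=
  spherical (Real.pi - c.2.2.2.2) (Real.pi / 5 + (k : ℝ) * (2 * Real.pi / 5))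

/-- The twelve points with the given parameters, labelled as in `rings`. -/
noncomputable def place (c : RingParam) : Fin 12 → S2 :=
  ![gnomonic c.1 c.2.1, northPoint c 0, northPoint c 1, northPoint c 2, northPoint c 3,
    northPoint c 4, southPoint c 0, southPoint c 1, southPoint c 2, southPoint c 3,
    southPoint c 4, spherical Real.pi 0]

theorem place_zero (c : RingParam) : place c 0 = gnomonic c.1 c.2.1 := rfl

theorem place_north (c : RingParam) (k : Fin 5) : place c (northLabel k) = northPoint c k := by
  fin_cases k <;> rfl

theorem place_south (c : RingParam) (k : Fin 5) : place c (southLabel k) = southPoint c k := by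
  fin_cases k <;> rfl

theorem place_last (c : RingParam) : place c 11 = spherical Real.pi 0 := rfl

theorem continuous_northPoint (k : Fin 5) : Continuous fun c => northPoint c k :=
  continuous_spherical.comp (f := fun c : RingParam =>
    (c.2.2.1 k, c.2.2.2.1 k + (k : ℝ) * (2 * Real.pi / 5))) (by fun_prop)

theorem continuous_southPoint (k : Fin 5) : Continuous fun c => southPoint c k :=
  continuous_spherical.comp (f := fun c : RingParam =>
    (Real.pi - c.2.2.2.2, Real.pi / 5 + (k : ℝ) * (2 * Real.pi / 5))) (by fun_prop)

theorem continuous_place : Continuous place := by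
  refine continuous_pi fun i => ?_
  rcases label_cases i with rfl | ⟨k, rfl⟩ | ⟨k, rfl⟩ | rfl
  · exact continuous_gnomonic.comp (f := fun c : RingParam => (c.1, c.2.1)) (by fun_prop)
  · simpa only [place_north] using continuous_northPoint k
  · simpa only [place_south] using continuous_southPoint k
  · exact continuous_const

/-- A symmetric relation holds between all points of a family if it holds between the different
kinds of points. -/
theorem place_pairwise {P : S2 → S2 → Prop} (hP : ∀ u v, P u v → P v u) (c : RingParam)
    (hNU : ∀ k, P (gnomonic c.1 c.2.1) (northPoint c k))
    (hNV : ∀ k, P (gnomonic c.1 c.2.1) (southPoint c k))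
    (hNS : P (gnomonic c.1 c.2.1) (spherical Real.pi 0))
    (hUU : ∀ j k, j ≠ k → P (northPoint c j) (northPoint c k))
    (hUV : ∀ j k, P (northPoint c j) (southPoint c k))
    (hUS : ∀ k, P (northPoint c k) (spherical Real.pi 0))
    (hVV : ∀ j k, j ≠ k → P (southPoint c j) (southPoint c k))
    (hVS : ∀ k, P (southPoint c k) (spherical Real.pi 0)) :
    ∀ i j, i ≠ j → P (place c i) (place c j) := by
  intro i j hij
  rcases label_cases i with rfl | ⟨k, rfl⟩ | ⟨k, rfl⟩ | rfl <;>
    rcases label_cases j with rfl | ⟨l, rfl⟩ | ⟨l, rfl⟩ | rfl <;>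
    simp only [place_zero, place_north, place_south, place_last]
  · exact absurd rfl hij
  · exact hNU _
  · exact hNV _
  · exact hNS
  · exact hP _ _ (hNU _)
  · exact hUU _ _ fun h => hij (h ▸ rfl)
  · exact hUV _ _
  · exact hUS _
  · exact hP _ _ (hNV _)
  · exact hP _ _ (hUV _ _)
  · exact hVV _ _ fun h => hij (h ▸ rfl)
  · exact hVS _
  · exact hP _ _ hNS
  · exact hP _ _ (hUS _)
  · exact hP _ _ (hVS _)
  · exact absurd rfl hij

theorem inner_gnomonic_northPoint (c : RingParam) (k : Fin 5) :
    inner ℝ (gnomonic c.1 c.2.1 : E3) (northPoint c k : E3) =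
      (Real.sin (c.2.2.1 k) * (c.1 * Real.cos (c.2.2.2.1 k + (k : ℝ) * (2 * Real.pi / 5)) +
        c.2.1 * Real.sin (c.2.2.2.1 k + (k : ℝ) * (2 * Real.pi / 5))) + Real.cos (c.2.2.1 k)) /
        √(1 + c.1 ^ 2 + c.2.1 ^ 2) :=
  inner_gnomonic_spherical _ _ _ _

theorem inner_gnomonic_southPoint (c : RingParam) (k : Fin 5) :
    inner ℝ (gnomonic c.1 c.2.1 : E3) (southPoint c k : E3) =
      (Real.sin c.2.2.2.2 * (c.1 * Real.cos (Real.pi / 5 + (k : ℝ) * (2 * Real.pi / 5)) +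
        c.2.1 * Real.sin (Real.pi / 5 + (k : ℝ) * (2 * Real.pi / 5))) - Real.cos c.2.2.2.2) /
        √(1 + c.1 ^ 2 + c.2.1 ^ 2) := by
  rw [southPoint, inner_gnomonic_spherical, Real.sin_pi_sub, Real.cos_pi_sub, ← sub_eq_add_neg]

theorem inner_gnomonic_southPole (x y : ℝ) :
    inner ℝ (gnomonic x y : E3) (spherical Real.pi 0 : E3) = -1 / √(1 + x ^ 2 + y ^ 2) := by
  rw [inner_gnomonic_spherical]; simp

theorem inner_northPoint_northPoint (c : RingParam) (j k : Fin 5) :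
    inner ℝ (northPoint c j : E3) (northPoint c k : E3) =
      Real.sin (c.2.2.1 j) * Real.sin (c.2.2.1 k) *
        Real.cos (((j : ℤ) - (k : ℤ) : ℤ) * (2 * Real.pi / 5) + (c.2.2.2.1 j - c.2.2.2.1 k)) +
        Real.cos (c.2.2.1 j) * Real.cos (c.2.2.1 k) := by
  rw [northPoint, northPoint, inner_spherical]
  congr 3; push_cast; ring

theorem inner_northPoint_southPoint (c : RingParam) (j k : Fin 5) :
    inner ℝ (northPoint c j : E3) (southPoint c k : E3) =
      Real.sin (c.2.2.1 j) * Real.sin c.2.2.2.2 *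
        Real.cos (((j : ℤ) - (k : ℤ) : ℤ) * (2 * Real.pi / 5) + (c.2.2.2.1 j - Real.pi / 5)) -
        Real.cos (c.2.2.1 j) * Real.cos c.2.2.2.2 := by
  rw [northPoint, southPoint, inner_spherical, Real.sin_pi_sub, Real.cos_pi_sub, mul_neg,
    ← sub_eq_add_neg]
  congr 3; push_cast; ring

theorem inner_northPoint_southPole (c : RingParam) (k : Fin 5) :
    inner ℝ (northPoint c k : E3) (spherical Real.pi 0 : E3) = -Real.cos (c.2.2.1 k) := by
  rw [northPoint, inner_spherical]; simp

theorem inner_southPoint_southPoint (c : RingParam) (j k : Fin 5) :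
    inner ℝ (southPoint c j : E3) (southPoint c k : E3) =
      Real.sin c.2.2.2.2 ^ 2 * Real.cos (((j : ℤ) - (k : ℤ) : ℤ) * (2 * Real.pi / 5)) +
        Real.cos c.2.2.2.2 ^ 2 := by
  rw [southPoint, southPoint, inner_spherical, Real.sin_pi_sub, Real.cos_pi_sub, neg_mul_neg,
    ← sq, ← sq]
  congr 3; push_cast; ring

theorem inner_southPoint_southPole (c : RingParam) (k : Fin 5) :
    inner ℝ (southPoint c k : E3) (spherical Real.pi 0 : E3) = Real.cos c.2.2.2.2 := by
  rw [southPoint, inner_spherical]; simp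

theorem fin_five_sub {j k : Fin 5} (h : j ≠ k) :
    ¬ (5 : ℤ) ∣ ((j : ℤ) - (k : ℤ)) ∧ ((j : ℤ) - (k : ℤ)) ≠ 0 := by
  have : (j : ℕ) ≠ k := fun hc => h (Fin.ext hc)
  omega

theorem abs_fin_five_sub (j k : Fin 5) : |(j : ℤ) - (k : ℤ)| < 5 := by
  rw [abs_lt]; omega

/-! ### Straight-line homotopies -/

/-- A convex set of parameters for which the twelve points are distinct. In gnomonic coordinates,
the northern points have distances `tan (p k) > p k` from the origin, whence the first
condition. -/
def admissible : Set RingParam :=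
  {c | (∀ k, |c.1| + |c.2.1| < c.2.2.1 k ∧ c.2.2.1 k < Real.pi / 2) ∧
    (∀ j k, |c.2.2.2.1 j - c.2.2.2.1 k| < 2 * Real.pi / 5) ∧
    0 < c.2.2.2.2 ∧ c.2.2.2.2 < Real.pi / 2}

theorem abs_convex_comb_le {a b : ℝ} (ha : 0 ≤ a) (hb : 0 ≤ b) (x y : ℝ) :
    |a * x + b * y| ≤ a * |x| + b * |y| := by
  refine (abs_add_le _ _).trans_eq ?_
  rw [abs_mul, abs_mul, abs_of_nonneg ha, abs_of_nonneg hb]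

theorem convex_comb_lt {a b u v u' v' : ℝ} (ha : 0 ≤ a) (hb : 0 ≤ b) (hab : a + b = 1)
    (h : u < u') (h' : v < v') : a * u + b * v < a * u' + b * v' := by
  rcases ha.eq_or_lt with rfl | ha
  · obtain rfl : b = 1 := by linarith
    simpa
  · have h1 := mul_lt_mul_of_pos_left h ha
    have h2 := mul_le_mul_of_nonneg_left h'.le hb
    linarith

theorem convex_admissible : Convex ℝ admissible := by
  rintro ⟨x, y, p, s, q⟩ ⟨h1, h2, h3, h4⟩ ⟨x', y', p', s', q'⟩ ⟨h1', h2', h3', h4'⟩ a b ha hb hab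
  have hconst (z : ℝ) : a * z + b * z = z := by rw [← add_mul, hab, one_mul]
  refine ⟨fun k => ⟨?_, ?_⟩, fun j k => ?_, ?_, ?_⟩ <;>
    simp only [Prod.smul_mk, Prod.mk_add_mk, Pi.add_apply, Pi.smul_apply, smul_eq_mul] at *
  · have := convex_comb_lt ha hb hab (h1 k).1 (h1' k).1
    have hx := abs_convex_comb_le ha hb x x'
    have hy := abs_convex_comb_le ha hb y y'
    linarith
  · simpa only [hconst] using convex_comb_lt ha hb hab (h1 k).2 (h1' k).2
  · have := convex_comb_lt ha hb hab (h2 j k) (h2' j k)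
    rw [hconst] at this
    refine lt_of_le_of_lt ?_ this
    rw [show a * s j + b * s' j - (a * s k + b * s' k) =
      a * (s j - s k) + b * (s' j - s' k) by ring]
    exact abs_convex_comb_le ha hb _ _
  · have := convex_comb_lt ha hb hab h3 h3'
    simpa using this
  · simpa only [hconst] using convex_comb_lt ha hb hab h4 h4'

theorem ne_of_inner_lt_one {u v : S2} (h : inner ℝ (u : E3) (v : E3) < 1) : u ≠ v := by
  rintro rfl
  rw [real_inner_self_eq_norm_sq] at h
  simp at h

theorem spherical_apply_two (p a : ℝ) : (spherical p a : E3) 2 = Real.cos p := by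
  simp [spherical]

theorem gnomonic_apply_two_pos (x y : ℝ) : 0 < (gnomonic x y : E3) 2 := by
  have h : 0 < 1 + x ^ 2 + y ^ 2 := by positivity
  simpa [gnomonic] using h

theorem ne_of_apply_two_lt {u v : S2} (h : (v : E3) 2 < (u : E3) 2) : u ≠ v := by
  rintro rfl
  exact lt_irrefl _ h

theorem gnomonic_ne_spherical {x y p a : ℝ} (h : |x| + |y| < p) (hp : p < Real.pi / 2) :
    gnomonic x y ≠ spherical p a := by
  intro heq
  have hp0 : 0 < p := lt_of_le_of_lt (by positivity) h
  have hc : 0 < Real.cos p := Real.cos_pos_of_mem_Ioo ⟨by linarith, hp⟩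
  have hi (i : Fin 3) : (gnomonic x y : E3) i = (spherical p a : E3) i := by rw [heq]
  have h0 := hi 0
  have h1 := hi 1
  have h2 := hi 2
  simp [gnomonic, spherical] at h0 h1 h2
  rw [h2] at h0 h1
  have h3 : Real.cos p * (x * Real.cos a + y * Real.sin a) = Real.sin p := by
    linear_combination Real.cos a * h0 + Real.sin a * h1 +
      Real.sin p * Real.sin_sq_add_cos_sq a
  have h4 : x * Real.cos a + y * Real.sin a ≤ |x| + |y| := by
    refine (le_abs_self _).trans ((abs_add_le _ _).trans ?_)
    rw [abs_mul, abs_mul]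
    exact add_le_add (mul_le_of_le_one_right (abs_nonneg _) (Real.abs_cos_le_one _))
      (mul_le_of_le_one_right (abs_nonneg _) (Real.abs_sin_le_one _))
  have h5 := Real.lt_tan hp0 hp
  rw [Real.tan_eq_sin_div_cos, lt_div_iff₀ hc] at h5
  nlinarith

theorem place_mem_conf {c : RingParam} (hc : c ∈ admissible) : place c ∈ conf 12 := by
  obtain ⟨h1, h2, h3, h4⟩ := hc
  have hp (k) : 0 < c.2.2.1 k := lt_of_le_of_lt (by positivity) (h1 k).1
  have hcp (k) : 0 < Real.cos (c.2.2.1 k) :=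
    Real.cos_pos_of_mem_Ioo ⟨by linarith [hp k], (h1 k).2⟩
  have hsp (k) : 0 < Real.sin (c.2.2.1 k) :=
    Real.sin_pos_of_pos_of_lt_pi (hp k) (by linarith [(h1 k).2])
  have hcq : 0 < Real.cos c.2.2.2.2 := Real.cos_pos_of_mem_Ioo ⟨by linarith, h4⟩
  have hcq1 : Real.cos c.2.2.2.2 < 1 := by
    rw [← Real.cos_zero]
    exact Real.cos_lt_cos_of_nonneg_of_le_pi le_rfl (by linarith) h3
  have hsq : 0 < Real.sin c.2.2.2.2 := Real.sin_pos_of_pos_of_lt_pi h3 (by linarith)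
  suffices h : ∀ i j, i ≠ j → place c i ≠ place c j from
    fun i j hij => by_contra fun hne => h i j hne hij
  have hV (k) : (southPoint c k : E3) 2 = -Real.cos c.2.2.2.2 := by
    rw [southPoint, spherical_apply_two, Real.cos_pi_sub]
  have hU (k) : (northPoint c k : E3) 2 = Real.cos (c.2.2.1 k) := spherical_apply_two _ _
  have hS : (spherical Real.pi 0 : E3) 2 = -1 := by rw [spherical_apply_two, Real.cos_pi]
  have hN := gnomonic_apply_two_pos c.1 c.2.1
  refine place_pairwise (fun _ _ h => h.symm) c (fun k => ?_) (fun k => ?_) ?_ (fun j k hjk => ?_)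
    (fun j k => ?_) (fun k => ?_) (fun j k hjk => ?_) (fun k => ?_)
  · exact gnomonic_ne_spherical (h1 k).1 (h1 k).2
  · exact ne_of_apply_two_lt (by rw [hV]; linarith)
  · exact ne_of_apply_two_lt (by rw [hS]; linarith)
  · refine ne_of_inner_lt_one ?_
    rw [inner_northPoint_northPoint]
    have h := cos_mul_two_pi_div_five_add_lt_one (abs_fin_five_sub j k)
      (fun h => absurd h (fin_five_sub hjk).2) (h2 j k)
    have h5 := Real.cos_le_one (c.2.2.1 j - c.2.2.1 k)
    rw [Real.cos_sub] at h5
    have := mul_lt_mul_of_pos_left h (mul_pos (hsp j) (hsp k))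
    linarith
  · exact ne_of_apply_two_lt (by rw [hV, hU]; linarith [hcp j])
  · exact ne_of_apply_two_lt (by rw [hS, hU]; linarith [hcp k])
  · refine ne_of_inner_lt_one ?_
    rw [inner_southPoint_southPoint]
    have h := cos_mul_two_pi_div_five_le (fin_five_sub hjk).1
    have h5 := sqrt_five_mem.2
    have := Real.sin_sq_add_cos_sq c.2.2.2.2
    nlinarith [pow_pos hsq 2]
  · exact ne_of_apply_two_lt (by rw [hV, hS]; linarith)

/-! ### Regular rings -/

/-- The parameters of `rings p a`. -/
def regularParam (p a : ℝ) : RingParam := (0, 0, fun _ => p, fun _ => a, p)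

theorem continuous_regularParam : Continuous fun z : ℝ × ℝ => regularParam z.1 z.2 := by
  unfold regularParam; fun_prop

theorem place_regularParam (p a : ℝ) : place (regularParam p a) = rings p a := by
  have hU (k : Fin 5) : place (regularParam p a) (northLabel k) = rings p a (northLabel k) := by
    rw [place_north]
    simp [northPoint, rings, northLabel, regularParam]
  have hV (k : Fin 5) : place (regularParam p a) (southLabel k) = rings p a (southLabel k) := by
    have h : (k : ℕ) ≤ 4 := by omega
    rw [place_south]
    simp [southPoint, rings, southLabel, regularParam, h]
  funext i
  rcases label_cases i with rfl | ⟨k, rfl⟩ | ⟨k, rfl⟩ | rfl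
  · rw [place_zero]; simp [rings, spherical_zero, regularParam]
  · exact hU k
  · exact hV k
  · rw [place_last]; simp [rings]

theorem regularParam_mem_admissible {p a : ℝ} (h0 : 0 < p) (h1 : p < Real.pi / 2) :
    regularParam p a ∈ admissible := by
  refine ⟨fun k => ⟨by simpa [regularParam] using h0, h1⟩, fun j k => ?_, h0, h1⟩
  simp only [regularParam, sub_self, abs_zero]
  have := Real.pi_pos
  positivity

/-- Two regular rings around opposite poles are compatible with balls of radius `r`, if their
distance from the poles lies between those of touching balls and of the icosahedron, and if the
two rings do not come too close to each other. -/
theorem rings_mem_confRadius {r p a : ℝ} (hr : 0 < r) (h1 : 1 / √5 ≤ Real.cos p)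
    (h2 : Real.cos p ≤ Real.cos (contactAngle r))
    (h3 : ∀ m : ℤ, Real.sin p ^ 2 * Real.cos (m * (2 * Real.pi / 5) + (a - Real.pi / 5)) -
      Real.cos p ^ 2 ≤ Real.cos (contactAngle r)) :
    rings p a ∈ confRadius 12 r := by
  rw [← place_regularParam, mem_confRadius_iff hr]
  have h5 := sqrt_five_mem
  have h5' : √5 ^ 2 = 5 := Real.sq_sqrt (by norm_num)
  rw [div_le_iff₀ (by linarith [h5.1])] at h1
  have hp : 0 < Real.cos p := by
    by_contra! hc
    nlinarith [h5.1]
  have hp1 := Real.cos_le_one p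
  have hsq := Real.sin_sq_add_cos_sq p
  have hring (m : ℤ) (hm : ¬ (5 : ℤ) ∣ m) :
      Real.sin p ^ 2 * Real.cos (m * (2 * Real.pi / 5)) + Real.cos p ^ 2 ≤
        Real.cos (contactAngle r) := by
    refine le_trans ?_ h2
    have h := mul_le_mul_of_nonneg_left (cos_mul_two_pi_div_five_le hm) (sq_nonneg (Real.sin p))
    refine (add_le_add_left h _).trans ?_
    rw [show Real.sin p ^ 2 = (1 - Real.cos p) * (1 + Real.cos p) by linarith]
    -- the difference is `(1 - cos p)` times a multiple of `√5 * cos p - 1`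
    have h6 : 0 ≤ (1 - Real.cos p) * ((Real.cos p * √5 - 1) * (√5 - 1)) :=
      mul_nonneg (by linarith) (mul_nonneg (by linarith) (by linarith [h5.1]))
    nlinarith
  refine place_pairwise (P := fun u v => inner ℝ (u : E3) (v : E3) ≤ Real.cos (contactAngle r))
    (fun u v h => by rwa [real_inner_comm]) _ (fun k => ?_) (fun k => ?_) ?_
    (fun j k hjk => ?_) (fun j k => ?_) (fun k => ?_) (fun j k hjk => ?_) (fun k => ?_)
  · rw [inner_gnomonic_northPoint]; simpa [regularParam] using h2
  · rw [inner_gnomonic_southPoint]; simp [regularParam]; linarith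
  · rw [inner_gnomonic_southPole]; simp [regularParam]; linarith
  · rw [inner_northPoint_northPoint]
    simpa [regularParam, ← sq] using hring _ (fin_five_sub hjk).1
  · rw [inner_northPoint_southPoint]
    simpa [regularParam, ← sq] using h3 (j - k)
  · rw [inner_northPoint_southPole]; simp [regularParam]; linarith
  · rw [inner_southPoint_southPoint]
    simpa [regularParam, ← sq] using hring _ (fin_five_sub hjk).1
  · rw [inner_southPoint_southPole]; simpa [regularParam] using h2

theorem cos_arctan_two : Real.cos (Real.arctan 2) = 1 / √5 := by
  rw [Real.cos_arctan]; norm_num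

theorem arctan_two_mem : Real.arctan 2 ∈ Set.Ioo (Real.pi / 3) (Real.pi / 2) := by
  refine ⟨?_, Real.arctan_lt_pi_div_two 2⟩
  rw [← Real.arctan_sqrt_three]
  refine Real.arctan_strictMono ?_
  rw [Real.sqrt_lt' (by norm_num)]; norm_num

/-- Staggered rings are compatible with balls of radius `r` throughout a meridional motion
between the icosahedron and the poles. -/
theorem staggered_rings_mem_confRadius {r p : ℝ} (hr : 0 < r) (h1 : contactAngle r ≤ p)
    (h2 : p ≤ Real.arctan 2) (n : ℤ) :
    rings p (n * (2 * Real.pi / 5)) ∈ confRadius 12 r := by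
  have hθ := contactAngle_mem hr
  have hat := arctan_two_mem
  have hpi := Real.pi_pos
  have hc1 : 1 / √5 ≤ Real.cos p := by
    rw [← cos_arctan_two]
    exact Real.cos_le_cos_of_nonneg_of_le_pi (by linarith [hθ.1]) (by linarith [hat.2]) h2
  have hc2 : Real.cos p ≤ Real.cos (contactAngle r) :=
    Real.cos_le_cos_of_nonneg_of_le_pi hθ.1.le (by linarith [hat.2]) h1
  refine rings_mem_confRadius hr hc1 hc2 fun m => le_trans ?_ hc2
  have h := cos_mul_two_pi_div_five_sub_le (m + n)
  rw [show ((m + n : ℤ) : ℝ) * (2 * Real.pi / 5) - Real.pi / 5 =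
    m * (2 * Real.pi / 5) + (n * (2 * Real.pi / 5) - Real.pi / 5) by push_cast; ring] at h
  have h5 := sqrt_five_mem
  have h5' : √5 ^ 2 = 5 := Real.sq_sqrt (by norm_num)
  rw [div_le_iff₀ (by linarith [h5.1])] at hc1
  have hsq := Real.sin_sq_add_cos_sq p
  have h3 := mul_le_mul_of_nonneg_left h (sq_nonneg (Real.sin p))
  have hp : 0 < Real.cos p := by
    by_contra! hc
    nlinarith [h5.1]
  refine (sub_le_sub_right h3 _).trans ?_
  rw [show Real.sin p ^ 2 = 1 - Real.cos p ^ 2 by linarith]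
  -- the difference is a multiple of `(√5 * cos p - 1) * (cos p + 1)`
  have h6 : 0 ≤ (Real.cos p * √5 - 1) * (Real.cos p + 1) :=
    mul_nonneg (by linarith) (by linarith)
  nlinarith

/-- Balls of radius at most one allow a ring of touching balls to be rotated rigidly. -/
theorem touching_rings_mem_confRadius {r : ℝ} (hr : 0 < r) (h1 : r ≤ 1) (a : ℝ) :
    rings (contactAngle r) a ∈ confRadius 12 r := by
  have h := contactAngle_mono hr h1
  rw [contactAngle_one] at h
  have hθ := contactAngle_mem hr
  have hc : 1 / 2 ≤ Real.cos (contactAngle r) := by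
    rw [← Real.cos_pi_div_three]
    exact Real.cos_le_cos_of_nonneg_of_le_pi hθ.1.le (by linarith [Real.pi_pos]) h
  refine rings_mem_confRadius hr (le_trans ?_ hc) le_rfl fun m => ?_
  · rw [div_le_div_iff₀ (by linarith [sqrt_five_mem.1]) (by norm_num)]
    linarith [sqrt_five_mem.1]
  · have h3 := mul_le_mul_of_nonneg_left (Real.cos_le_one
      (m * (2 * Real.pi / 5) + (a - Real.pi / 5))) (sq_nonneg (Real.sin (contactAngle r)))
    have := Real.sin_sq_add_cos_sq (contactAngle r)
    nlinarith

/-! ### Rings passing one ball at a time -/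

/-- Infinitesimal data `(x, y, c, s)`: a horizontal velocity `(x, y)` of the north pole, downward
velocities `c k` of the points of a northern ring at polar distance `π/3`, and their longitudes
`s k + k * (2π/5)`. The points of the southern ring have upward velocity `1`. -/
abbrev Deformation : Type := ℝ × ℝ × (Fin 5 → ℝ) × (Fin 5 → ℝ)

/-- The configuration that is reached at time `t` by a deformation. -/
noncomputable def deform (t : ℝ) (d : Deformation) : RingParam :=
  (t * d.1, t * d.2.1, fun k => Real.pi / 3 + Real.arctan (t * d.2.2.1 k), d.2.2.2,
    Real.pi / 3 + Real.arctan t)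

/-- The deformations that separate all unit balls to first order: neighbours in the northern ring
do not touch, every ball of that ring goes away from the ball at the north pole, and a ball that is
at the longitude of a southern ball goes up faster than that one. -/
def separating : Set Deformation :=
  {d | (∀ k, 0 ≤ d.2.2.2 k ∧ d.2.2.2 k ≤ 2 * Real.pi / 5) ∧
    (∀ j k, |d.2.2.2 j - d.2.2.2 k| ≤ 1 / 50) ∧
    (∀ k, d.1 * Real.cos (d.2.2.2 k + (k : ℝ) * (2 * Real.pi / 5)) +
      d.2.1 * Real.sin (d.2.2.2 k + (k : ℝ) * (2 * Real.pi / 5)) < d.2.2.1 k) ∧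
    ∀ k, d.2.2.2 k ≠ Real.pi / 5 ∨ d.2.2.1 k < -1}

theorem continuous_deform : Continuous fun z : ℝ × Deformation => deform z.1 z.2 := by
  unfold deform
  fun_prop

theorem deform_zero (d : Deformation) :
    deform 0 d = (0, 0, fun _ => Real.pi / 3, d.2.2.2, Real.pi / 3) := by
  simp [deform]

theorem continuous_inner_place_deform (i j : Fin 12) : Continuous fun z : ℝ × Deformation =>
    inner ℝ (place (deform z.1 z.2) i : E3) (place (deform z.1 z.2) j : E3) := by
  have h (i : Fin 12) : Continuous fun z : ℝ × Deformation => (place (deform z.1 z.2) i : E3) :=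
    continuous_subtype_val.comp
      ((continuous_apply i).comp (continuous_place.comp continuous_deform))
  exact (h i).inner (h j)

theorem sin_pi_div_three_add_arctan (x : ℝ) :
    Real.sin (Real.pi / 3 + Real.arctan x) = (√3 / 2 + x / 2) / √(1 + x ^ 2) := by
  rw [Real.sin_add, Real.sin_pi_div_three, Real.cos_pi_div_three, Real.sin_arctan,
    Real.cos_arctan]
  ring

theorem cos_pi_div_three_add_arctan (x : ℝ) :
    Real.cos (Real.pi / 3 + Real.arctan x) = (1 / 2 - √3 / 2 * x) / √(1 + x ^ 2) := by
  rw [Real.cos_add, Real.sin_pi_div_three, Real.cos_pi_div_three, Real.sin_arctan,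
    Real.cos_arctan]
  ring

theorem one_le_sqrt_one_add {x : ℝ} (hx : 0 ≤ x) : 1 ≤ √(1 + x) :=
  Real.one_le_sqrt.2 (by linarith)

theorem div_lt_half {u v : ℝ} (hu : u < 1 / 2) (hv : 1 ≤ v) : u / v < 1 / 2 := by
  rw [div_lt_iff₀ (by linarith)]; linarith

/-- A point of the northern ring separates from the displaced pole. -/
theorem eventually_inner_north_lt {d : Deformation} (hd : d ∈ separating) (k : Fin 5) :
    ∀ᶠ z : ℝ × Deformation in 𝓝 (0, d), 0 < z.1 →
      inner ℝ (place (deform z.1 z.2) 0 : E3) (place (deform z.1 z.2) (northLabel k) : E3) <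
        1 / 2 := by
  let m : Deformation → ℝ := fun d => d.1 * Real.cos (d.2.2.2 k + (k : ℝ) * (2 * Real.pi / 5)) +
      d.2.1 * Real.sin (d.2.2.2 k + (k : ℝ) * (2 * Real.pi / 5))
  have hm : m d < d.2.2.1 k := hd.2.2.1 k
  have hcont : Continuous fun z : ℝ × Deformation =>
      √3 / 2 * (m z.2 - z.2.2.2.1 k) + z.1 * z.2.2.2.1 k * m z.2 / 2 := by
    simp only [m]; fun_prop
  have h0 : √3 / 2 * (m d - d.2.2.1 k) + 0 * d.2.2.1 k * m d / 2 < 0 := by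
    have : 0 < √3 := by positivity
    nlinarith
  filter_upwards [hcont.continuousAt.eventually_lt continuousAt_const h0] with z hz ht
  rw [place_zero, place_north, inner_gnomonic_northPoint]
  have heq : (deform z.1 z.2).1 * Real.cos ((deform z.1 z.2).2.2.2.1 k +
      (k : ℝ) * (2 * Real.pi / 5)) + (deform z.1 z.2).2.1 *
      Real.sin ((deform z.1 z.2).2.2.2.1 k + (k : ℝ) * (2 * Real.pi / 5)) = z.1 * m z.2 := by
    simp only [deform, m]; ring
  rw [heq]
  refine div_lt_half ?_ (by rw [add_assoc]; exact one_le_sqrt_one_add (by positivity))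
  change Real.sin (Real.pi / 3 + Real.arctan (z.1 * z.2.2.2.1 k)) * (z.1 * m z.2) +
    Real.cos (Real.pi / 3 + Real.arctan (z.1 * z.2.2.2.1 k)) < 1 / 2
  rw [sin_pi_div_three_add_arctan, cos_pi_div_three_add_arctan, div_mul_eq_mul_div, ← add_div]
  refine div_lt_half ?_ (one_le_sqrt_one_add (sq_nonneg _))
  nlinarith [mul_neg_of_pos_of_neg ht hz]

/-- A point of the northern ring separates from a point of the southern ring. -/
theorem eventually_inner_north_south_lt {d : Deformation} (hd : d ∈ separating) (j k : Fin 5) :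
    ∀ᶠ z : ℝ × Deformation in 𝓝 (0, d), 0 < z.1 →
      inner ℝ (place (deform z.1 z.2) (northLabel j) : E3)
        (place (deform z.1 z.2) (southLabel k) : E3) < 1 / 2 := by
  have h3 : √3 ^ 2 = 3 := Real.sq_sqrt (by norm_num)
  have hpi := Real.pi_pos
  by_cases h : ((j : ℤ) - (k : ℤ)) = 0 ∧ d.2.2.2 j = Real.pi / 5
  · have hc : d.2.2.1 j < -1 := (hd.2.2.2 j).resolve_left (not_not.2 h.2)
    have hcont : Continuous fun z : ℝ × Deformation => z.2.2.2.1 j := by fun_prop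
    have hcont' : Continuous fun z : ℝ × Deformation => z.1 * z.2.2.2.1 j := by fun_prop
    have hcont'' : Continuous fun z : ℝ × Deformation => z.1 := by fun_prop
    have ha : -(Real.pi / 3) < Real.arctan (0 * d.2.2.1 j) := by simp; positivity
    have hb : -(Real.pi / 3) < Real.arctan 0 := by simp; positivity
    filter_upwards [hcont.continuousAt.eventually_lt continuousAt_const hc,
      continuousAt_const.eventually_lt
        (Real.continuous_arctan.comp hcont').continuousAt ha] with z hz hz1 ht
    rw [place_north, place_south, inner_northPoint_southPoint]
    change Real.sin (Real.pi / 3 + Real.arctan (z.1 * z.2.2.2.1 j)) *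
      Real.sin (Real.pi / 3 + Real.arctan z.1) * Real.cos _ -
      Real.cos (Real.pi / 3 + Real.arctan (z.1 * z.2.2.2.1 j)) *
      Real.cos (Real.pi / 3 + Real.arctan z.1) < 1 / 2
    simp only [Function.comp_apply] at hz1
    have hA := Real.arctan_lt_pi_div_two (z.1 * z.2.2.2.1 j)
    have hT := Real.arctan_lt_pi_div_two z.1
    have hT0 := Real.arctan_pos.2 ht
    -- the two points are closest when they are on the same meridian
    have hsum : Real.arctan (z.1 * z.2.2.2.1 j) < -Real.arctan z.1 := by
      rw [← Real.arctan_neg]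
      exact Real.arctan_strictMono (by nlinarith)
    have hs1 : 0 ≤ Real.sin (Real.pi / 3 + Real.arctan (z.1 * z.2.2.2.1 j)) :=
      Real.sin_nonneg_of_nonneg_of_le_pi (by linarith) (by linarith)
    have hs2 : 0 ≤ Real.sin (Real.pi / 3 + Real.arctan z.1) :=
      Real.sin_nonneg_of_nonneg_of_le_pi (by linarith) (by linarith)
    refine lt_of_le_of_lt (sub_le_sub_right
      (mul_le_of_le_one_right (mul_nonneg hs1 hs2) (Real.cos_le_one _)) _) ?_
    have hcos := Real.cos_lt_cos_of_nonneg_of_le_pi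
      (x := Real.pi / 3 + Real.arctan (z.1 * z.2.2.2.1 j) + (Real.pi / 3 + Real.arctan z.1))
      (y := Real.pi - Real.pi / 3) (by linarith) (by linarith) (by linarith)
    rw [Real.cos_pi_sub, Real.cos_pi_div_three, Real.cos_add] at hcos
    linarith
  · have hlt : Real.cos (((j : ℤ) - (k : ℤ) : ℤ) * (2 * Real.pi / 5) +
        (d.2.2.2 j - Real.pi / 5)) < 1 := by
      refine cos_mul_two_pi_div_five_add_lt_one (abs_fin_five_sub j k)
        (fun h1 h2 => h ⟨h1, by linarith⟩) ?_
      have := hd.1 j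
      rw [abs_lt]; constructor <;> linarith
    refine ((continuous_inner_place_deform _ _).continuousAt.eventually_lt continuousAt_const
      ?_).mono fun z hz _ => hz
    simp only [place_north, place_south, inner_northPoint_southPoint, deform_zero,
      Real.sin_pi_div_three, Real.cos_pi_div_three]
    nlinarith

theorem eventually_inner_north_north_lt {d : Deformation} (hd : d ∈ separating) {j k : Fin 5}
    (hjk : j ≠ k) :
    ∀ᶠ z : ℝ × Deformation in 𝓝 (0, d),
      inner ℝ (place (deform z.1 z.2) (northLabel j) : E3)
        (place (deform z.1 z.2) (northLabel k) : E3) < 1 / 2 := by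
  refine (continuous_inner_place_deform _ _).continuousAt.eventually_lt continuousAt_const ?_
  simp only [place_north, inner_northPoint_northPoint, deform_zero,
    Real.sin_pi_div_three, Real.cos_pi_div_three]
  have h3 : √3 ^ 2 = 3 := Real.sq_sqrt (by norm_num)
  have h5 := sqrt_five_mem.2
  have h := cos_mul_two_pi_div_five_le (fin_five_sub hjk).1
  -- `cos (2π/5) + 1/50 < 1/3`, and the cosine is Lipschitz
  have hlip := (abs_le.1 (Real.abs_cos_sub_cos_le
    ((((j : ℤ) - (k : ℤ) : ℤ) : ℝ) * (2 * Real.pi / 5) + (d.2.2.2 j - d.2.2.2 k))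
    ((((j : ℤ) - (k : ℤ) : ℤ) : ℝ) * (2 * Real.pi / 5)))).2
  rw [add_sub_cancel_left] at hlip
  have := hd.2.1 j k
  nlinarith

/-- For small positive times, all balls are separated strictly. -/
theorem eventually_separated {d : Deformation} (hd : d ∈ separating) :
    ∀ᶠ z : ℝ × Deformation in 𝓝 (0, d), 0 < z.1 → z.2 ∈ separating →
      deform z.1 z.2 ∈ admissible ∧ ∀ i j, i ≠ j →
        inner ℝ (place (deform z.1 z.2) i : E3) (place (deform z.1 z.2) j : E3) < 1 / 2 := by
  have hpi := Real.pi_pos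
  have h3 : √3 ^ 2 = 3 := Real.sq_sqrt (by norm_num)
  have hplain (i j : Fin 12)
      (h : inner ℝ (place (deform 0 d) i : E3) (place (deform 0 d) j : E3) < 1 / 2) :
      ∀ᶠ z : ℝ × Deformation in 𝓝 (0, d),
        inner ℝ (place (deform z.1 z.2) i : E3) (place (deform z.1 z.2) j : E3) < 1 / 2 :=
    (continuous_inner_place_deform i j).continuousAt.eventually_lt continuousAt_const h
  have hNU := eventually_all.2 fun k => eventually_inner_north_lt hd k
  have hNV := eventually_all.2 fun k => hplain 0 (southLabel k) (by
    rw [place_zero, place_south, inner_gnomonic_southPoint]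
    norm_num [deform_zero])
  have hNS := hplain 0 11 (by
    rw [place_zero, place_last, inner_gnomonic_southPole]
    norm_num [deform_zero])
  have hUU := eventually_all.2 fun j => eventually_all.2 fun k => eventually_all.2 fun hjk =>
    eventually_inner_north_north_lt hd (j := j) (k := k) hjk
  have hUV := eventually_all.2 fun j => eventually_all.2 fun k =>
    eventually_inner_north_south_lt hd j k
  have hUS := eventually_all.2 fun k => hplain (northLabel k) 11 (by
    rw [place_north, place_last, inner_northPoint_southPole]
    norm_num [deform_zero])
  have hVV := eventually_all.2 fun j => eventually_all.2 fun k => eventually_all.2 fun hjk : j ≠ k =>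
    hplain (southLabel j) (southLabel k) (by
      rw [place_south, place_south, inner_southPoint_southPoint]
      simp only [deform_zero, Real.sin_pi_div_three, Real.cos_pi_div_three]
      have := cos_mul_two_pi_div_five_le (fin_five_sub hjk).1
      nlinarith [sqrt_five_mem.2])
  have hadm : ∀ᶠ z : ℝ × Deformation in 𝓝 (0, d), ∀ k,
      |(deform z.1 z.2).1| + |(deform z.1 z.2).2.1| < (deform z.1 z.2).2.2.1 k ∧
      (deform z.1 z.2).2.2.1 k < Real.pi / 2 := by
    refine eventually_all.2 fun k => Filter.Eventually.and ?_ ?_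
    · refine ContinuousAt.eventually_lt (Continuous.continuousAt ?_)
        (Continuous.continuousAt ?_) ?_
      · unfold deform; fun_prop
      · unfold deform; fun_prop
      · simp [deform_zero]; positivity
    · refine ContinuousAt.eventually_lt (Continuous.continuousAt ?_) continuousAt_const ?_
      · unfold deform; fun_prop
      · simp only [deform_zero]; linarith
  have hq : ∀ᶠ z : ℝ × Deformation in 𝓝 (0, d),
      Real.pi / 3 + Real.arctan z.1 < Real.pi / 2 := by
    refine ContinuousAt.eventually_lt (Continuous.continuousAt ?_) continuousAt_const ?_
    · fun_prop
    · simp only [Real.arctan_zero]; linarith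
  filter_upwards [hNU, hNV, hNS, hUU, hUV, hUS, hVV, hadm, hq]
    with z hNU hNV hNS hUU hUV hUS hVV hadm hq ht hz
  have hT := Real.arctan_pos.2 ht
  refine ⟨⟨hadm, fun j k => lt_of_le_of_lt (hz.2.1 j k) ?_, ?_, hq⟩, ?_⟩
  · linarith [Real.pi_gt_three]
  · change 0 < Real.pi / 3 + Real.arctan z.1
    linarith
  · simp only [place_zero, place_north, place_south, place_last] at hNU hNV hNS hUU hUV hUS hVV
    refine place_pairwise (P := fun u v => inner ℝ (u : E3) (v : E3) < 1 / 2)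
      (fun u v h => by rwa [real_inner_comm]) _ (fun k => hNU k ht) hNV hNS hUU
      (fun j k => hUV j k ht) hUS hVV fun k => ?_
    rw [inner_southPoint_southPole, ← Real.cos_pi_div_three]
    refine Real.cos_lt_cos_of_nonneg_of_le_pi (by linarith) ?_ ?_
    · change Real.pi / 3 + Real.arctan z.1 ≤ Real.pi; linarith
    · change Real.pi / 3 < Real.pi / 3 + Real.arctan z.1; linarith

theorem joinedIn_of_continuous {E : Type*} [TopologicalSpace E] {F : Set E} {f : ℝ → E} {x y : E}
    (hf : Continuous f) (h0 : f 0 = x) (h1 : f 1 = y) (h : ∀ t ∈ Set.Icc (0 : ℝ) 1, f t ∈ F) :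
    JoinedIn F x y :=
  JoinedIn.ofLine hf.continuousOn h0 h1 (by rintro _ ⟨t, ht, rfl⟩; exact h t ht)

/-- The deformation of a northern ring of the given longitudes towards the equator. -/
def descent (s : Fin 5 → ℝ) : Deformation := (0, 0, fun _ => 1, s)

theorem descent_mem_separating {s : Fin 5 → ℝ} (h1 : ∀ k, 0 ≤ s k ∧ s k ≤ 2 * Real.pi / 5)
    (h2 : ∀ j k, |s j - s k| ≤ 1 / 50) (h3 : ∀ k, s k ≠ Real.pi / 5) :
    descent s ∈ separating :=
  ⟨h1, h2, fun k => by simp [descent], fun k => Or.inl (h3 k)⟩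

theorem joinedIn_descent_const {a b : ℝ} (ha : a ∈ Set.Icc 0 (2 * Real.pi / 5))
    (hb : b ∈ Set.Icc 0 (2 * Real.pi / 5))
    (h : a < Real.pi / 5 ∧ b < Real.pi / 5 ∨ Real.pi / 5 < a ∧ Real.pi / 5 < b) :
    JoinedIn separating (descent fun _ => a) (descent fun _ => b) := by
  refine joinedIn_of_continuous (f := fun t => descent fun _ => (1 - t) * a + t * b)
    (by unfold descent; fun_prop) (by simp) (by simp) fun t ht => ?_
  have h1 := ht.1
  have h2 : 0 ≤ 1 - t := by linarith [ht.2]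
  refine descent_mem_separating (fun k => ?_) (fun j k => by simp) fun k => ?_
  · exact (convex_Icc 0 (2 * Real.pi / 5)) ha hb h2 h1 (by ring)
  · rcases h with h | h
    · exact ((convex_Iio (Real.pi / 5)) h.1 h.2 h2 h1 (by ring)).ne
    · exact ((convex_Ioi (Real.pi / 5)) h.1 h.2 h2 h1 (by ring)).ne'

/-- The deformation during the passage of the ball `i`: the pole is displaced away from that ball,
which goes up, while the other balls of the northern ring go down. The velocity `3` of the pole
exceeds the upward velocity `2` of the ball `i`, and is less than the downward velocity `4` of the
other ones. -/
noncomputable def passage (i : Fin 5) (s : Fin 5 → ℝ) : Deformation :=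
  (-3 * Real.cos (Real.pi / 5 + (i : ℝ) * (2 * Real.pi / 5)),
    -3 * Real.sin (Real.pi / 5 + (i : ℝ) * (2 * Real.pi / 5)),
    fun k => if k = i then -2 else 4, s)

theorem passage_velocity_lt {i k : Fin 5} {s : Fin 5 → ℝ} (hs : |s k - Real.pi / 5| ≤ 1 / 100) :
    (passage i s).1 * Real.cos (s k + (k : ℝ) * (2 * Real.pi / 5)) +
      (passage i s).2.1 * Real.sin (s k + (k : ℝ) * (2 * Real.pi / 5)) <
      (passage i s).2.2.1 k := by
  have h : (passage i s).1 * Real.cos (s k + (k : ℝ) * (2 * Real.pi / 5)) +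
      (passage i s).2.1 * Real.sin (s k + (k : ℝ) * (2 * Real.pi / 5)) =
      -3 * Real.cos (s k + (k : ℝ) * (2 * Real.pi / 5) -
        (Real.pi / 5 + (i : ℝ) * (2 * Real.pi / 5))) := by
    rw [Real.cos_sub]; simp only [passage]; ring
  rw [h]
  simp only [passage]
  split_ifs with hk
  · subst hk
    -- `s k` is so close to `π/5` that `3 * cos (s k - π/5) > 2`
    rw [add_sub_add_right_eq_sub]
    have := Real.one_sub_sq_div_two_le_cos (x := s k - Real.pi / 5)
    have h2 := sq_abs (s k - Real.pi / 5)
    nlinarith [abs_nonneg (s k - Real.pi / 5)]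
  · linarith [Real.neg_one_le_cos (s k + (k : ℝ) * (2 * Real.pi / 5) -
        (Real.pi / 5 + (i : ℝ) * (2 * Real.pi / 5)))]

theorem longitude_bounds {s : Fin 5 → ℝ} (hs : ∀ k, |s k - Real.pi / 5| ≤ 1 / 100) :
    (∀ k, 0 ≤ s k ∧ s k ≤ 2 * Real.pi / 5) ∧ ∀ j k, |s j - s k| ≤ 1 / 50 := by
  have hpi := Real.pi_gt_three
  refine ⟨fun k => ?_, fun j k => ?_⟩
  · have := abs_le.1 (hs k)
    constructor <;> linarith
  · have h1 := abs_le.1 (hs k)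
    have h2 := abs_le.1 (hs j)
    rw [abs_le]; constructor <;> linarith

theorem joinedIn_descent_passage {s : Fin 5 → ℝ} (hs : ∀ k, |s k - Real.pi / 5| ≤ 1 / 100)
    (h : ∀ k, s k ≠ Real.pi / 5) (i : Fin 5) :
    JoinedIn separating (descent s) (passage i s) := by
  refine joinedIn_of_continuous (f := fun t => (t * (passage i s).1, t * (passage i s).2.1,
    fun k => (1 - t) * 1 + t * (passage i s).2.2.1 k, s)) (by fun_prop)
    (by simp [descent]) (by simp [passage]) fun t ht => ?_
  refine ⟨(longitude_bounds hs).1, (longitude_bounds hs).2, fun k => ?_, fun k => Or.inl (h k)⟩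
  have := convex_comb_lt (a := 1 - t) (by linarith [ht.2]) ht.1 (by ring) zero_lt_one
    (passage_velocity_lt (i := i) (hs k))
  simp only at this ⊢
  linarith

/-- One ball of the northern ring passes a southern ball, the others staying at a distance from
the longitudes of the southern balls. -/
theorem joinedIn_pass {s : Fin 5 → ℝ} (hs : ∀ k, |s k - Real.pi / 5| ≤ 1 / 100)
    (h : ∀ k, s k ≠ Real.pi / 5) {i : Fin 5} {b : ℝ} (hb : |b - Real.pi / 5| ≤ 1 / 100)
    (hb' : b ≠ Real.pi / 5) :
    JoinedIn separating (descent s) (descent (Function.update s i b)) := by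
  have hup (u : ℝ) (hu : |u - Real.pi / 5| ≤ 1 / 100) (k : Fin 5) :
      |Function.update s i u k - Real.pi / 5| ≤ 1 / 100 := by
    rcases eq_or_ne k i with rfl | hk
    · simpa using hu
    · simpa [hk] using hs k
  refine (joinedIn_descent_passage hs h i).trans (JoinedIn.trans ?_
    (joinedIn_descent_passage (hup b hb) (fun k => ?_) i).symm)
  · refine joinedIn_of_continuous
      (f := fun t => passage i (Function.update s i ((1 - t) * s i + t * b)))
      (by unfold passage; fun_prop) (by simp) (by simp) fun t ht => ?_
    have hu : |((1 - t) * s i + t * b) - Real.pi / 5| ≤ 1 / 100 := by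
      have h1 := abs_le.1 (hs i)
      have h2 := abs_le.1 hb
      have h3 := ht.1
      have h4 : 0 ≤ 1 - t := by linarith [ht.2]
      rw [abs_le]; constructor <;> nlinarith
    have hs' := hup _ hu
    refine ⟨(longitude_bounds hs').1, (longitude_bounds hs').2,
      fun k => passage_velocity_lt (hs' k), fun k => ?_⟩
    rcases eq_or_ne k i with rfl | hk
    · right; simp [passage]
    · left; simpa [passage, hk] using h k
  · rcases eq_or_ne k i with rfl | hk
    · simpa using hb'
    · simpa [hk] using h k

/-- The longitudes when the first `n` balls of the northern ring have passed the southern ones. -/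
noncomputable def passedLongitudes (n : ℕ) (k : Fin 5) : ℝ :=
  if (k : ℕ) < n then Real.pi / 5 + 1 / 100 else Real.pi / 5 - 1 / 100

theorem passedLongitudes_succ {n : ℕ} (hn : n < 5) : passedLongitudes (n + 1) =
    Function.update (passedLongitudes n) ⟨n, hn⟩ (Real.pi / 5 + 1 / 100) := by
  funext k
  rcases eq_or_ne k ⟨n, hn⟩ with rfl | hk
  · simp [passedLongitudes]
  · have : (k : ℕ) ≠ n := fun h => hk (Fin.ext h)
    have h2 : (k : ℕ) < n + 1 ↔ (k : ℕ) < n := by omega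
    simp [passedLongitudes, hk, h2]

theorem joinedIn_passedLongitudes {n : ℕ} (hn : n ≤ 5) :
    JoinedIn separating (descent (passedLongitudes 0)) (descent (passedLongitudes n)) := by
  have hs (n : ℕ) (k : Fin 5) : |passedLongitudes n k - Real.pi / 5| ≤ 1 / 100 := by
    rw [passedLongitudes]; split_ifs <;> norm_num
  have hne (n : ℕ) (k : Fin 5) : passedLongitudes n k ≠ Real.pi / 5 := by
    rw [passedLongitudes]; split_ifs <;> norm_num
  induction n with
  | zero =>
    exact JoinedIn.refl (descent_mem_separating (longitude_bounds (hs 0)).1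
      (longitude_bounds (hs 0)).2 (hne 0))
  | succ n ih =>
    refine (ih (by omega)).trans ?_
    rw [passedLongitudes_succ (by omega)]
    exact joinedIn_pass (hs n) (hne n) (by norm_num) (by norm_num)

/-- The northern ring can be rotated by `2π/5` through separating deformations. -/
theorem joinedIn_separating :
    JoinedIn separating (descent fun _ => 0) (descent fun _ => 2 * Real.pi / 5) := by
  have hpi := Real.pi_gt_three
  have h := joinedIn_passedLongitudes le_rfl
  have h0 : passedLongitudes 0 = fun _ => Real.pi / 5 - 1 / 100 := by
    funext k; simp [passedLongitudes]
  have h5 : passedLongitudes 5 = fun _ => Real.pi / 5 + 1 / 100 := by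
    funext k; simp [passedLongitudes]
  rw [h0, h5] at h
  refine (joinedIn_descent_const ?_ ?_ (Or.inl ?_)).trans
    (h.trans (joinedIn_descent_const ?_ ?_ (Or.inr ?_)))
  all_goals constructor <;> linarith

/-! ### Rotating the northern ring for radii beyond one -/

/-- The parameters of configurations for balls of radius `r`. -/
def allowed (r : ℝ) : Set RingParam := {c | c ∈ admissible ∧ place c ∈ confRadius 12 r}

theorem regularParam_mem_allowed {r p : ℝ} (hr : 0 < r) (h1 : contactAngle r ≤ p)
    (h2 : p ≤ Real.arctan 2) (n : ℤ) :
    regularParam p (n * (2 * Real.pi / 5)) ∈ allowed r := by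
  refine ⟨regularParam_mem_admissible ?_ ?_, ?_⟩
  · linarith [(contactAngle_mem hr).1]
  · linarith [arctan_two_mem.2]
  · rw [place_regularParam]
    exact staggered_rings_mem_confRadius hr h1 h2 n

theorem joinedIn_allowed_of_le_one {r : ℝ} (hr : 0 < r) (h1 : r ≤ 1) :
    JoinedIn (allowed r) (regularParam (contactAngle r) 0)
      (regularParam (contactAngle r) (2 * Real.pi / 5)) := by
  have hθ := contactAngle_mono hr h1
  rw [contactAngle_one] at hθ
  have hpi := Real.pi_pos
  refine joinedIn_of_continuous
    (f := fun t => regularParam (contactAngle r) (t * (2 * Real.pi / 5)))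
    (continuous_regularParam.comp (f := fun t : ℝ => (contactAngle r, t * (2 * Real.pi / 5)))
      (by fun_prop)) (by simp) (by simp) fun t _ => ⟨?_, ?_⟩
  · exact regularParam_mem_admissible (contactAngle_mem hr).1 (by linarith)
  · rw [place_regularParam]
    exact touching_rings_mem_confRadius hr h1 _

theorem joinedIn_allowed_meridional {r p : ℝ} (hr : 0 < r) (h1 : contactAngle r ≤ p)
    (h2 : p ≤ Real.arctan 2) (n : ℤ) :
    JoinedIn (allowed r) (regularParam (contactAngle r) (n * (2 * Real.pi / 5)))
      (regularParam p (n * (2 * Real.pi / 5))) := by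
  refine joinedIn_of_continuous
    (f := fun t => regularParam ((1 - t) * contactAngle r + t * p) (n * (2 * Real.pi / 5)))
    (continuous_regularParam.comp
      (f := fun t : ℝ => ((1 - t) * contactAngle r + t * p, n * (2 * Real.pi / 5)))
      (by fun_prop)) (by simp) (by simp) fun t ht => ?_
  have h : (1 - t) * contactAngle r + t * p ∈ Set.Icc (contactAngle r) (Real.arctan 2) :=
    (convex_Icc _ _) ⟨le_rfl, h1.trans h2⟩ ⟨h1, h2⟩ (by linarith [ht.2]) ht.1 (by ring)
  exact regularParam_mem_allowed hr h.1 h.2 n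

theorem deform_descent (t : ℝ) (a : ℝ) :
    deform t (descent fun _ => a) = regularParam (Real.pi / 3 + Real.arctan t) a := by
  simp [deform, descent, regularParam]

/-- For some radius greater than one, a northern ring of touching balls can be rotated by
`2π/5`. -/
theorem exists_radius : ∃ r₁ : ℝ, 1 < r₁ ∧ ∀ r : ℝ, 0 < r → r ≤ r₁ →
    contactAngle r < Real.arctan 2 ∧
    JoinedIn (allowed r) (regularParam (contactAngle r) 0)
      (regularParam (contactAngle r) (2 * Real.pi / 5)) := by
  obtain ⟨γ, hγ⟩ := joinedIn_separating
  have hK : IsCompact (Set.range γ) := isCompact_range γ.continuous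
  have hKs : ∀ d ∈ Set.range γ, d ∈ separating := by
    rintro _ ⟨t, rfl⟩; exact hγ t
  -- a small time at which all configurations of the path are strictly separated
  have h1 := hK.eventually_forall_of_forall_eventually (x₀ := (0 : ℝ))
    (P := fun t d => 0 < t → d ∈ separating → deform t d ∈ admissible ∧ ∀ i j, i ≠ j →
        inner ℝ (place (deform t d) i : E3) (place (deform t d) j : E3) < 1 / 2)
    fun d hd => eventually_separated (hKs d hd)
  have h2 : ∀ᶠ t in 𝓝 (0 : ℝ), Real.pi / 3 + Real.arctan t < Real.arctan 2 := by
    refine ContinuousAt.eventually_lt (Continuous.continuousAt (by fun_prop)) continuousAt_const ?_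
    simpa using arctan_two_mem.1
  obtain ⟨t, ⟨h1, h2⟩, ht : 0 < t⟩ := (((h1.and h2).filter_mono nhdsWithin_le_nhds).and
    (self_mem_nhdsWithin : Set.Ioi (0 : ℝ) ∈ 𝓝[>] 0)).exists
  -- by compactness these configurations leave room for larger balls
  have h3 := hK.eventually_forall_of_forall_eventually (x₀ := (1 : ℝ))
    (P := fun r d => ∀ i j, i ≠ j →
      inner ℝ (place (deform t d) i : E3) (place (deform t d) j : E3) <
        Real.cos (contactAngle r)) fun d hd => by
    refine eventually_all.2 fun i => eventually_all.2 fun j => eventually_all.2 fun hij => ?_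
    refine ContinuousAt.eventually_lt (Continuous.continuousAt ?_) ?_ ?_
    · exact (continuous_inner_place_deform i j).comp (f := fun z : ℝ × Deformation => (t, z.2))
        (by fun_prop)
    · exact Real.continuous_cos.continuousAt.comp
        (ContinuousAt.comp (f := Prod.fst) (x := ((1 : ℝ), d)) continuousAt_contactAngle_one
          continuousAt_fst)
    · rw [contactAngle_one, Real.cos_pi_div_three]
      exact (h1 d hd ht (hKs d hd)).2 i j hij
  have h4 : ∀ᶠ r in 𝓝 (1 : ℝ), contactAngle r < Real.pi / 3 + Real.arctan t := by
    refine continuousAt_contactAngle_one.eventually_lt continuousAt_const ?_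
    rw [contactAngle_one]
    linarith [Real.arctan_pos.2 ht]
  obtain ⟨r₁, ⟨h3, h4⟩, hr₁ : 1 < r₁⟩ := (((h3.and h4).filter_mono nhdsWithin_le_nhds).and
    (self_mem_nhdsWithin : Set.Ioi (1 : ℝ) ∈ 𝓝[>] 1)).exists
  refine ⟨r₁, hr₁, fun r hr hr' => ?_⟩
  have hθ := contactAngle_mono hr hr'
  refine ⟨by linarith, ?_⟩
  rcases le_or_gt r 1 with hr1 | hr1
  · exact joinedIn_allowed_of_le_one hr hr1
  have hmem : ∀ d ∈ Set.range γ, deform t d ∈ allowed r := fun d hd =>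
    ⟨(h1 d hd ht (hKs d hd)).1, confRadius_anti hr hr'
      ((mem_confRadius_iff (by linarith)).2 fun i j hij => (h3 d hd i j hij).le)⟩
  have hmid : JoinedIn (allowed r) (regularParam (Real.pi / 3 + Real.arctan t) 0)
      (regularParam (Real.pi / 3 + Real.arctan t) (2 * Real.pi / 5)) := by
    rw [← deform_descent, ← deform_descent]
    have hc : Continuous fun d => deform t d :=
      continuous_deform.comp (f := fun d : Deformation => (t, d)) (by fun_prop)
    exact ⟨γ.map hc, fun u => hmem _ ⟨u, rfl⟩⟩
  have hA := joinedIn_allowed_meridional hr (p := Real.pi / 3 + Real.arctan t) (by linarith)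
    h2.le 0
  have hB := joinedIn_allowed_meridional hr (p := Real.pi / 3 + Real.arctan t) (by linarith)
    h2.le 1
  rw [Int.cast_zero, zero_mul] at hA
  rw [Int.cast_one, one_mul] at hB
  exact hA.trans (hmid.trans hB.symm)

/-! ### The modified moves -/

/-- The polar distance of the rings at time `t` of the unmodified move. -/
noncomputable def ringDistance (r t : ℝ) : ℝ :=
  (1 - min 1 (min (3 * t) (3 * (1 - t)))) * Real.arctan 2 +
    min 1 (min (3 * t) (3 * (1 - t))) * contactAngle r

/-- The parameters at time `t` of the unmodified move. -/
noncomputable def rigidParam (r t : ℝ) : RingParam :=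
  regularParam (ringDistance r t) (max 0 (min 1 (3 * t - 1)) * (2 * Real.pi / 5))

theorem place_rigidParam (r t : ℝ) : place (rigidParam r t) = rigidM5 r t :=
  place_regularParam _ _

theorem continuous_ringDistance (r : ℝ) : Continuous (ringDistance r) := by
  unfold ringDistance; fun_prop

theorem continuous_rigidParam (r : ℝ) : Continuous (rigidParam r) := by
  have := continuous_ringDistance r
  exact continuous_regularParam.comp
    (f := fun t => (ringDistance r t, max 0 (min 1 (3 * t - 1)) * (2 * Real.pi / 5)))
    (by fun_prop)

theorem ringDistance_mem {r t : ℝ} (hr : contactAngle r ≤ Real.arctan 2)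
    (ht : t ∈ Set.Icc (0 : ℝ) 1) :
    ringDistance r t ∈ Set.Icc (contactAngle r) (Real.arctan 2) := by
  have h0 : 0 ≤ min 1 (min (3 * t) (3 * (1 - t))) :=
    le_min zero_le_one (le_min (by linarith [ht.1]) (by linarith [ht.2]))
  have h1 : min 1 (min (3 * t) (3 * (1 - t))) ≤ 1 := min_le_left _ _
  exact (convex_Icc _ _) (Set.right_mem_Icc.2 hr) (Set.left_mem_Icc.2 hr) (by linarith) h0
    (by ring)

theorem ringDistance_of_middle {r t : ℝ} (h1 : 1 / 3 ≤ t) (h2 : t ≤ 2 / 3) :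
    ringDistance r t = contactAngle r := by
  have : min 1 (min (3 * t) (3 * (1 - t))) = 1 :=
    min_eq_left (le_min (by linarith) (by linarith))
  rw [ringDistance, this]; ring

theorem rigidParam_zero (r : ℝ) : rigidParam r 0 = regularParam (Real.arctan 2) 0 := by
  simp [rigidParam, ringDistance]

theorem rigidParam_one (r : ℝ) :
    rigidParam r 1 = regularParam (Real.arctan 2) (2 * Real.pi / 5) := by
  have h : max 0 (min 1 (3 * 1 - 1)) = (1 : ℝ) := by norm_num
  rw [rigidParam, ringDistance, h]
  simp

theorem rigidParam_of_le {r t : ℝ} (h : t ≤ 1 / 3) :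
    rigidParam r t = regularParam (ringDistance r t) 0 := by
  have : max 0 (min 1 (3 * t - 1)) = 0 :=
    max_eq_left ((min_le_right _ _).trans (by linarith))
  rw [rigidParam, this, zero_mul]

theorem rigidParam_of_ge {r t : ℝ} (h : 2 / 3 ≤ t) :
    rigidParam r t = regularParam (ringDistance r t) (2 * Real.pi / 5) := by
  have : max 0 (min 1 (3 * t - 1)) = 1 := by
    rw [min_eq_left (by linarith)]; norm_num
  rw [rigidParam, this, one_mul]

theorem rigidParam_mem_admissible {r t : ℝ} (hr : 0 < r) (h : contactAngle r ≤ Real.arctan 2)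
    (ht : t ∈ Set.Icc (0 : ℝ) 1) : rigidParam r t ∈ admissible := by
  have := ringDistance_mem h ht
  exact regularParam_mem_admissible (by linarith [this.1, (contactAngle_mem hr).1])
    (by linarith [this.2, arctan_two_mem.2])

/-- A motion of the parameters of touching rings is extended by meridional phases. -/
theorem exists_param_motion {r : ℝ} (hr : 0 < r) (h : contactAngle r ≤ Real.arctan 2)
    (hj : JoinedIn (allowed r) (regularParam (contactAngle r) 0)
      (regularParam (contactAngle r) (2 * Real.pi / 5))) :
    ∃ c : unitInterval → RingParam, Continuous c ∧ (∀ t, c t ∈ allowed r) ∧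
      ∀ t : unitInterval, (t : ℝ) ≤ 1 / 3 ∨ 2 / 3 ≤ (t : ℝ) → c t = rigidParam r t := by
  obtain ⟨γ, hγ⟩ := hj
  let e : ℝ → RingParam := fun u => (0, 0, fun _ => u, 0, u)
  have he : Continuous e := by simp only [e]; fun_prop
  let c : unitInterval → RingParam := fun t =>
    γ.extend (3 * (t : ℝ) - 1) + e (ringDistance r t - contactAngle r)
  have hreg (a : ℝ) (t : unitInterval) :
      regularParam (contactAngle r) a + e (ringDistance r t - contactAngle r) =
        regularParam (ringDistance r t) a := by
    simp only [regularParam, e, Prod.mk_add_mk, Prod.mk.injEq]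
    refine ⟨by simp, by simp, ?_, by simp, by simp⟩
    funext k; simp
  have hleft (t : unitInterval) (ht : (t : ℝ) ≤ 1 / 3) : c t = rigidParam r t := by
    simp only [c]
    rw [rigidParam_of_le ht, γ.extend_of_le_zero (by linarith), hreg]
  have hright (t : unitInterval) (ht : 2 / 3 ≤ (t : ℝ)) : c t = rigidParam r t := by
    simp only [c]
    rw [rigidParam_of_ge ht, γ.extend_of_one_le (by linarith), hreg]
  refine ⟨c, ?_, fun t => ?_, fun t ht => ht.elim (hleft t) (hright t)⟩
  · have := continuous_ringDistance r
    exact (γ.continuous_extend.comp (by fun_prop)).add (he.comp (by fun_prop))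
  · have hd := ringDistance_mem h t.2
    rcases le_or_gt (t : ℝ) (1 / 3) with h1 | h1
    · rw [hleft t h1, rigidParam_of_le h1]
      simpa using regularParam_mem_allowed hr hd.1 hd.2 0
    rcases le_or_gt (2 / 3) (t : ℝ) with h2 | h2
    · rw [hright t h2, rigidParam_of_ge h2]
      simpa using regularParam_mem_allowed hr hd.1 hd.2 1
    · simp only [c]
      rw [ringDistance_of_middle h1.le h2.le, sub_self]
      have he0 : e 0 = 0 := rfl
      rw [he0, add_zero, γ.extend_apply ⟨by linarith, by linarith⟩]
      exact hγ _

theorem continuous_rotateConf {N : ℕ} (R : E3 ≃ₗᵢ[ℝ] E3) :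
    Continuous (rotateConf R : (Fin N → S2) → Fin N → S2) := by
  refine continuous_pi fun i => Continuous.subtype_mk ?_ _
  exact R.continuous.comp (continuous_subtype_val.comp (continuous_apply i))

theorem rotateConf_mem_confRadius {N : ℕ} {r : ℝ} {R : E3 ≃ₗᵢ[ℝ] E3} {U : Fin N → S2}
    (h : U ∈ confRadius N r) : rotateConf R U ∈ confRadius N r := by
  intro i j hij
  exact (h i j hij).trans_eq (R.toLinearIsometry.angle_map (U i) (U j)).symm

theorem comp_perm_mem_confRadius {N : ℕ} {r : ℝ} {U : Fin N → S2} (h : U ∈ confRadius N r)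
    (π : Equiv.Perm (Fin N)) : U ∘ π ∈ confRadius N r :=
  fun i j hij => h (π i) (π j) (π.injective.ne hij)

theorem rotateConf_mem_conf {N : ℕ} {R : E3 ≃ₗᵢ[ℝ] E3} {U : Fin N → S2}
    (h : U ∈ conf N) : rotateConf R U ∈ conf N :=
  fun _ _ hij => h (Subtype.ext (R.injective (congrArg Subtype.val hij)))

theorem continuous_comp_perm {N : ℕ} (π : Equiv.Perm (Fin N)) :
    Continuous fun U : Fin N → S2 => U ∘ π :=
  continuous_pi fun i => continuous_apply (π i)

/-- The modified move exists for all radii for which touching rings can be rotated. -/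
theorem exists_isModifiedM5 {r : ℝ} (hr : 0 < r) (h : contactAngle r ≤ Real.arctan 2)
    (hj : JoinedIn (allowed r) (regularParam (contactAngle r) 0)
      (regularParam (contactAngle r) (2 * Real.pi / 5)))
    (R : E3 ≃ₗᵢ[ℝ] E3) (π : Equiv.Perm (Fin 12)) :
    ∃ γ : unitInterval → Fin 12 → S2, IsModifiedM5 r R π γ := by
  obtain ⟨c, hc, hmem, heq⟩ := exists_param_motion hr h hj
  let F : RingParam → Fin 12 → S2 := fun c => rotateConf R (place c ∘ π)
  have hF : Continuous F :=
    (continuous_rotateConf R).comp ((continuous_comp_perm π).comp continuous_place)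
  have h1 : contactAngle 1 ≤ Real.arctan 2 := by
    rw [contactAngle_one]; exact arctan_two_mem.1.le
  have h0 (t : unitInterval) : rigidParam 1 t ∈ admissible :=
    rigidParam_mem_admissible one_pos h1 t.2
  have hc0 : c 0 = rigidParam 1 (0 : unitInterval) := by
    rw [heq 0 (Or.inl (by norm_num))]; simp [rigidParam_zero]
  have hc1 : c 1 = rigidParam 1 (1 : unitInterval) := by
    rw [heq 1 (Or.inr (by norm_num))]; simp [rigidParam_one]
  have hcont1 := continuous_rigidParam 1
  refine ⟨fun t => F (c t), hF.comp hc, fun t => ?_, fun t ht => ?_,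
    fun z => F ((1 - (z.1 : ℝ)) • c z.2 + (z.1 : ℝ) • rigidParam 1 z.2), ?_, fun s t => ?_,
    fun t => ?_, fun t => ?_, fun s => ?_, fun s => ?_⟩
  · exact rotateConf_mem_confRadius (comp_perm_mem_confRadius (hmem t).2 π)
  · simp only [F, heq t ht, place_rigidParam]
  · exact hF.comp (by fun_prop)
  · refine rotateConf_mem_conf (Function.Injective.comp ?_ π.injective)
    exact place_mem_conf (convex_admissible (hmem t).1 (h0 t) (by linarith [s.2.2]) s.2.1
      (by ring))
  · simp
  · simp [F, place_rigidParam]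
  · simp only [hc0, ← add_smul]; simp
  · simp only [hc1, ← add_smul]; simp

/-! ### Generating the alternating group -/

/-- The effect of the `M₅`-move on the labels: a cyclic permutation of the northern ring. -/
def ringShift : Equiv.Perm (Fin 12) where
  toFun := ![0, 2, 3, 4, 5, 1, 6, 7, 8, 9, 10, 11]
  invFun := ![0, 5, 1, 2, 3, 4, 6, 7, 8, 9, 10, 11]
  left_inv := by decide
  right_inv := by decide

/-- The effect on the vertices of `dod` of the rotation by `2π/5` about the polar axis. -/
def axialTurn : Equiv.Perm (Fin 12) where
  toFun := ![0, 2, 3, 4, 5, 1, 7, 8, 9, 10, 6, 11]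
  invFun := ![0, 5, 1, 2, 3, 4, 10, 6, 7, 8, 9, 11]
  left_inv := by decide
  right_inv := by decide

/-- The effect on the vertices of `dod` of the half-turn that exchanges the vertices `0`
and `1`. -/
def halfTurn : Equiv.Perm (Fin 12) where
  toFun := ![1, 0, 5, 10, 6, 2, 4, 9, 11, 7, 3, 8]
  invFun := ![1, 0, 5, 10, 6, 2, 4, 9, 11, 7, 3, 8]
  left_inv := by decide
  right_inv := by decide

theorem sign_ringShift : Equiv.Perm.sign ringShift = 1 := by decide

theorem isMultiplyPretransitive_of_base {G : Type*} [Group G] {α : Type*} [MulAction G α] {a b : α}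
    (h : ∀ x y, x ≠ y → ∃ g : G, g • x = a ∧ g • y = b) :
    MulAction.IsMultiplyPretransitive G α 2 := by
  rw [MulAction.is_two_pretransitive_iff]
  intro x y z w hxy hzw
  obtain ⟨g, hg1, hg2⟩ := h x y hxy
  obtain ⟨k, hk1, hk2⟩ := h z w hzw
  exact ⟨k⁻¹ * g, by rw [mul_smul, hg1, ← hk1, inv_smul_smul],
    by rw [mul_smul, hg2, ← hk2, inv_smul_smul]⟩

set_option maxRecDepth 4000 in
/-- The five-cycles around the vertices of the icosahedron generate the alternating group: they
act doubly transitively, and two of them generate a three-cycle. -/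
theorem alternatingGroup_le_of_ringShift_mem {H : Subgroup (Equiv.Perm (Fin 12))}
    (h0 : ringShift ∈ H) (hh : ∀ x ∈ H, halfTurn⁻¹ * x * halfTurn ∈ H)
    (hz : ∀ x ∈ H, axialTurn⁻¹ * x * axialTurn ∈ H) : alternatingGroup (Fin 12) ≤ H := by
  have h1 : c[0, 5, 10, 6, 2] ∈ H := by
    convert hh _ h0 using 1; decide
  have h2 : c[0, 4, 9, 10, 1] ∈ H := by
    convert hz _ h1 using 1; decide
  have h3 : c[0, 1, 6, 7, 3] ∈ H := by
    convert hh _ h2 using 1; decide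
  have h4 : c[0, 3, 8, 9, 5] ∈ H := by
    convert hz _ h2 using 1; decide
  have h5 : c[1, 10, 11, 7, 2] ∈ H := by
    convert hh _ h4 using 1; decide
  have h6 : c[1, 5, 9, 11, 6] ∈ H := by
    convert hz _ h5 using 1; decide
  have h7 : c[4, 8, 11, 10, 5] ∈ H := by
    convert hz _ h6 using 1; decide
  have h8 : c[3, 7, 11, 9, 4] ∈ H := by
    convert hz _ h7 using 1; decide
  have h9 : c[6, 10, 9, 8, 7] ∈ H := by
    convert hh _ h8 using 1; decide
  have hfix : ∀ y : Fin 12, y ≠ 0 → ∃ g ∈ H, g 0 = 0 ∧ g y = 1 := by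
    intro y hy
    have key : ∀ y : Fin 12, y ≠ 0 → ∃ i j k : Fin 5,
        (c[1, 10, 11, 7, 2] ^ (i : ℕ) * ringShift ^ (j : ℕ) *
          c[6, 10, 9, 8, 7] ^ (k : ℕ) : Equiv.Perm (Fin 12)) 0 = 0 ∧
        (c[1, 10, 11, 7, 2] ^ (i : ℕ) * ringShift ^ (j : ℕ) *
          c[6, 10, 9, 8, 7] ^ (k : ℕ) : Equiv.Perm (Fin 12)) y = 1 := by decide
    obtain ⟨i, j, k, h⟩ := key y hy
    exact ⟨_, H.mul_mem (H.mul_mem (H.pow_mem h5 _) (H.pow_mem h0 _)) (H.pow_mem h9 _), h⟩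
  have hbase : ∀ x : Fin 12, ∃ g ∈ H, g x = 0 := by
    intro x
    rcases eq_or_ne x 0 with rfl | hx
    · exact ⟨1, H.one_mem, rfl⟩
    · obtain ⟨g, hg, -, hgx⟩ := hfix x hx
      exact ⟨_, H.mul_mem (H.inv_mem h3) hg, by rw [Equiv.Perm.mul_apply, hgx]; decide⟩
  have h2t : MulAction.IsMultiplyPretransitive H (Fin 12) 2 := by
    refine isMultiplyPretransitive_of_base (a := 0) (b := 1) fun x y hxy => ?_
    obtain ⟨g, hg, hgx⟩ := hbase x
    obtain ⟨k, hk, hk0, hky⟩ := hfix (g y) fun h => hxy (g.injective (hgx.trans h.symm))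
    refine ⟨⟨k * g, H.mul_mem hk hg⟩, ?_, ?_⟩
    · change k (g x) = 0
      rw [hgx, hk0]
    · exact hky
  have h3c : Equiv.Perm.IsThreeCycle ((c[0, 5, 10, 6, 2] * ringShift) ^ 5) := by
    have h : (c[0, 5, 10, 6, 2] * ringShift) ^ 5 = Equiv.swap 0 5 * Equiv.swap 0 1 := by decide
    rw [h]
    exact Equiv.Perm.isThreeCycle_swap_mul_swap_same (by decide) (by decide) (by decide)
  exact Equiv.Perm.alternatingGroup_le_of_isPreprimitive_of_isThreeCycle_mem
    (MulAction.isPreprimitive_of_is_two_pretransitive h2t) h3c (H.pow_mem (H.mul_mem h1 h0) 5)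

/-! ### Rotational symmetries of the icosahedron -/

theorem isRotation_trans {R S : E3 ≃ₗᵢ[ℝ] E3} (hR : IsRotation R) (hS : IsRotation S) :
    IsRotation (R.trans S) := by
  unfold IsRotation at *
  have h : ((R.trans S).toLinearEquiv : E3 →ₗ[ℝ] E3) =
      (S.toLinearEquiv : E3 →ₗ[ℝ] E3) * (R.toLinearEquiv : E3 →ₗ[ℝ] E3) := rfl
  rw [h, map_mul, hR, hS, one_mul]

theorem isRotation_symm {R : E3 ≃ₗᵢ[ℝ] E3} (hR : IsRotation R) : IsRotation R.symm := by
  unfold IsRotation at *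
  have h : (R.symm.toLinearEquiv : E3 →ₗ[ℝ] E3) * (R.toLinearEquiv : E3 →ₗ[ℝ] E3) = 1 := by
    ext1 x; simp
  have h2 := congrArg LinearMap.det h
  rwa [map_mul, hR, mul_one, map_one] at h2

/-- A matrix of determinant one that preserves the norm defines a rotation. -/
theorem exists_isRotation_of_matrix (A : Matrix (Fin 3) (Fin 3) ℝ) (hdet : A.det = 1)
    (hnorm : ∀ v : E3, ‖Matrix.toEuclideanLin A v‖ = ‖v‖) :
    ∃ R : E3 ≃ₗᵢ[ℝ] E3, IsRotation R ∧ ∀ v, R v = Matrix.toEuclideanLin A v := by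
  let f : E3 →ₗᵢ[ℝ] E3 := ⟨Matrix.toEuclideanLin A, hnorm⟩
  refine ⟨f.toLinearIsometryEquiv rfl, ?_, fun v => rfl⟩
  have h : ((f.toLinearIsometryEquiv rfl).toLinearEquiv : E3 →ₗ[ℝ] E3) =
      Matrix.toEuclideanLin A := by
    ext1 v; rfl
  rw [IsRotation, h, Matrix.toEuclideanLin, Matrix.toLpLin_eq_toLin, LinearMap.det_toLin, hdet]

theorem dod_eq_place : dod = place (regularParam (Real.arctan 2) 0) := (place_regularParam _ _).symm

theorem spherical_add_two_pi (p a : ℝ) : spherical p (a + 2 * Real.pi) = spherical p a := by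
  simp [spherical]

theorem spherical_pentagon_succ (p a : ℝ) (k : Fin 5) :
    spherical p (a + (k : ℝ) * (2 * Real.pi / 5) + 2 * Real.pi / 5) =
      spherical p (a + ((k + 1 : Fin 5) : ℝ) * (2 * Real.pi / 5)) := by
  rcases Fin.eq_castSucc_or_eq_last k with ⟨j, rfl⟩ | rfl
  · rw [Fin.coeSucc_eq_succ, Fin.val_succ, Fin.val_castSucc]
    congr 1
    push_cast; ring
  · rw [show Fin.last 4 + 1 = 0 from rfl, ← spherical_add_two_pi p (a + ((0 : Fin 5) : ℝ) * _)]
    congr 1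
    simp; ring

theorem northPoint_turn (p : ℝ) (k : Fin 5) :
    northPoint (regularParam p (2 * Real.pi / 5)) k = northPoint (regularParam p 0) (k + 1) := by
  simp only [northPoint, regularParam]
  rw [← spherical_pentagon_succ]
  congr 1; ring

theorem rings_turn (p : ℝ) : rings p (2 * Real.pi / 5) = rings p 0 ∘ ringShift := by
  rw [← place_regularParam, ← place_regularParam]
  funext i
  rw [Function.comp_apply]
  rcases label_cases i with rfl | ⟨k, rfl⟩ | ⟨k, rfl⟩ | rfl
  · rw [show ringShift 0 = 0 by decide, place_zero, place_zero]; rfl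
  · have h : ringShift (northLabel k) = northLabel (k + 1) := by revert k; decide
    rw [h, place_north, place_north, northPoint_turn]
  · have h : ringShift (southLabel k) = southLabel k := by revert k; decide
    rw [h, place_south, place_south]; rfl
  · rw [show ringShift 11 = 11 by decide, place_last, place_last]

theorem exists_rotation_axialTurn :
    ∃ R : E3 ≃ₗᵢ[ℝ] E3, IsRotation R ∧ rotateConf R dod = dod ∘ axialTurn := by
  obtain ⟨R, hR, hRv⟩ := exists_isRotation_of_matrix
    !![Real.cos (2 * Real.pi / 5), -Real.sin (2 * Real.pi / 5), 0;
      Real.sin (2 * Real.pi / 5), Real.cos (2 * Real.pi / 5), 0; 0, 0, 1]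
    (by
      have := Real.sin_sq_add_cos_sq (2 * Real.pi / 5)
      simp [Matrix.det_fin_three]; nlinarith)
    (fun v => by
      rw [EuclideanSpace.norm_eq, EuclideanSpace.norm_eq]
      congr 1
      simp [Fin.sum_univ_three, Matrix.toEuclideanLin, Matrix.mulVec, dotProduct]
      linear_combination (v 0 ^ 2 + v 1 ^ 2) * Real.sin_sq_add_cos_sq (2 * Real.pi / 5))
  refine ⟨R, hR, ?_⟩
  have hs (p a : ℝ) : R (spherical p a : E3) = spherical p (a + 2 * Real.pi / 5) := by
    rw [hRv]
    ext i
    fin_cases i <;>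
      simp [spherical, Matrix.toEuclideanLin, Real.cos_add, Real.sin_add] <;> ring
  have hN (k : Fin 5) : R (northPoint (regularParam (Real.arctan 2) 0) k : E3) =
      northPoint (regularParam (Real.arctan 2) 0) (k + 1) := by
    rw [← northPoint_turn, northPoint, hs, northPoint]
    simp only [regularParam]
    congr 2; ring
  have hS (k : Fin 5) : R (southPoint (regularParam (Real.arctan 2) 0) k : E3) =
      southPoint (regularParam (Real.arctan 2) 0) (k + 1) := by
    rw [southPoint, hs, southPoint, spherical_pentagon_succ]
  rw [dod_eq_place]
  funext i
  refine Subtype.ext ?_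
  rw [Function.comp_apply]
  change R (place (regularParam (Real.arctan 2) 0) i : E3) = _
  rcases label_cases i with rfl | ⟨k, rfl⟩ | ⟨k, rfl⟩ | rfl
  · rw [show axialTurn 0 = 0 by decide, place_zero]
    change R (gnomonic 0 0 : E3) = (gnomonic 0 0 : E3)
    rw [← spherical_zero 0, hs, spherical_zero, spherical_zero]
  · have h : axialTurn (northLabel k) = northLabel (k + 1) := by revert k; decide
    rw [h, place_north, place_north, hN]
  · have h : axialTurn (southLabel k) = southLabel (k + 1) := by revert k; decide
    rw [h, place_south, place_south, hS]
  · rw [show axialTurn 11 = 11 by decide, place_last]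
    rw [hs, spherical_pi _ 0]

theorem sin_arctan_two : Real.sin (Real.arctan 2) = 2 / √5 := by
  rw [Real.sin_arctan]; norm_num

/-- The directions of a regular pentagon; those of the southern ring below are the opposite
ones. -/
theorem cos_sin_north (k : Fin 5) :
    Real.cos ((k : ℝ) * (2 * Real.pi / 5)) =
      ![1, (√5 - 1) / 4, -((1 + √5) / 4), -((1 + √5) / 4), (√5 - 1) / 4] k ∧
    Real.sin ((k : ℝ) * (2 * Real.pi / 5)) =
      ![0, Real.sin (2 * Real.pi / 5), Real.sin (Real.pi / 5), -Real.sin (Real.pi / 5),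
        -Real.sin (2 * Real.pi / 5)] k := by
  have e2 : 2 * (2 * Real.pi / 5) = Real.pi - Real.pi / 5 := by ring
  have e3 : 3 * (2 * Real.pi / 5) = Real.pi / 5 + Real.pi := by ring
  have e4 : 4 * (2 * Real.pi / 5) = 2 * Real.pi - 2 * Real.pi / 5 := by ring
  have h1 := cos_two_pi_div_five
  have h2 := Real.cos_pi_div_five
  fin_cases k
  · simp
  · simp [h1]
  · simp [e2, h2]
  · simp [e3, Real.cos_add_pi, Real.sin_add_pi, h2]
  · simp [e4, Real.cos_two_pi_sub, Real.sin_two_pi_sub, h1]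

theorem cos_sin_south (k : Fin 5) :
    Real.cos (Real.pi / 5 + (k : ℝ) * (2 * Real.pi / 5)) =
      ![(1 + √5) / 4, -((√5 - 1) / 4), -1, -((√5 - 1) / 4), (1 + √5) / 4] k ∧
    Real.sin (Real.pi / 5 + (k : ℝ) * (2 * Real.pi / 5)) =
      ![Real.sin (Real.pi / 5), Real.sin (2 * Real.pi / 5), 0, -Real.sin (2 * Real.pi / 5),
        -Real.sin (Real.pi / 5)] k := by
  have e1 : Real.pi / 5 + 2 * Real.pi / 5 = Real.pi - 2 * Real.pi / 5 := by ring
  have e2 : Real.pi / 5 + 2 * (2 * Real.pi / 5) = Real.pi := by ring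
  have e3 : Real.pi / 5 + 3 * (2 * Real.pi / 5) = 2 * Real.pi / 5 + Real.pi := by ring
  have e4 : Real.pi / 5 + 4 * (2 * Real.pi / 5) = 2 * Real.pi - Real.pi / 5 := by ring
  have h1 := cos_two_pi_div_five
  have h2 := Real.cos_pi_div_five
  fin_cases k
  · simp [h2]
  · simp [e1, h1]
  · simp [e2]
  · simp [e3, Real.cos_add_pi, Real.sin_add_pi, h1]
  · simp [e4, Real.cos_two_pi_sub, Real.sin_two_pi_sub, h2]

theorem coe_northPoint (k : Fin 5) : (northPoint (regularParam (Real.arctan 2) 0) k : E3) =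
    !₂[2 / √5 * ![1, (√5 - 1) / 4, -((1 + √5) / 4), -((1 + √5) / 4), (√5 - 1) / 4] k,
      2 / √5 * ![0, Real.sin (2 * Real.pi / 5), Real.sin (Real.pi / 5), -Real.sin (Real.pi / 5),
        -Real.sin (2 * Real.pi / 5)] k, 1 / √5] := by
  rw [← (cos_sin_north k).1, ← (cos_sin_north k).2, ← sin_arctan_two, ← cos_arctan_two]
  simp [northPoint, spherical, regularParam]

theorem coe_southPoint (k : Fin 5) : (southPoint (regularParam (Real.arctan 2) 0) k : E3) =
    !₂[2 / √5 * ![(1 + √5) / 4, -((√5 - 1) / 4), -1, -((√5 - 1) / 4), (1 + √5) / 4] k,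
      2 / √5 * ![Real.sin (Real.pi / 5), Real.sin (2 * Real.pi / 5), 0,
        -Real.sin (2 * Real.pi / 5), -Real.sin (Real.pi / 5)] k, -(1 / √5)] := by
  rw [← (cos_sin_south k).1, ← (cos_sin_south k).2, ← sin_arctan_two, ← cos_arctan_two]
  simp [southPoint, spherical, regularParam]

theorem exists_rotation_halfTurn :
    ∃ R : E3 ≃ₗᵢ[ℝ] E3, IsRotation R ∧ rotateConf R dod = dod ∘ halfTurn := by
  have h5 : √5 ^ 2 = 5 := Real.sq_sqrt (by norm_num)
  have h5' : √5 ≠ 0 := by positivity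
  obtain ⟨R, hR, hRv⟩ := exists_isRotation_of_matrix
    !![-(1 / √5), 0, 2 / √5; 0, -1, 0; 2 / √5, 0, 1 / √5]
    (by
      simp [Matrix.det_fin_three]
      field_simp
      linarith)
    (fun v => by
      rw [EuclideanSpace.norm_eq, EuclideanSpace.norm_eq]
      congr 1
      simp [Fin.sum_univ_three, Matrix.toEuclideanLin, Matrix.mulVec, dotProduct]
      field_simp
      rw [h5]; ring)
  refine ⟨R, hR, ?_⟩
  have hv (x y z : ℝ) : R !₂[x, y, z] =
      !₂[-(1 / √5) * x + 2 / √5 * z, -y, 2 / √5 * x + 1 / √5 * z] := by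
    rw [hRv]
    ext i
    fin_cases i <;> simp [Matrix.toEuclideanLin] <;> ring
  have h0 : (gnomonic 0 0 : E3) = !₂[0, 0, 1] := by simp [gnomonic]
  have h11 : (spherical Real.pi 0 : E3) = !₂[0, 0, -1] := by simp [spherical]
  rw [dod_eq_place]
  funext i
  refine Subtype.ext ?_
  rw [Function.comp_apply]
  change R (place (regularParam (Real.arctan 2) 0) i : E3) = _
  have e1 : (regularParam (Real.arctan 2) 0).1 = 0 := rfl
  have e2 : (regularParam (Real.arctan 2) 0).2.1 = 0 := rfl
  fin_cases i <;>
    simp [place, halfTurn, coe_northPoint, coe_southPoint, e1, e2, h0, h11, hv]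
  all_goals constructor <;> field_simp <;> linarith

/-! ### Connectedness of the rotation group -/

/-- Two isometries move every configuration into the same path component. -/
def ConfJoined (N : ℕ) (r : ℝ) (A B : E3 ≃ₗᵢ[ℝ] E3) : Prop :=
  ∀ U ∈ confRadius N r, JoinedIn (confRadius N r) (rotateConf A U) (rotateConf B U)

namespace ConfJoined

variable {N : ℕ} {r : ℝ} {A B C : E3 ≃ₗᵢ[ℝ] E3}

theorem refl (A : E3 ≃ₗᵢ[ℝ] E3) : ConfJoined N r A A :=
  fun _ hU => JoinedIn.refl (rotateConf_mem_confRadius hU)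

theorem trans (h : ConfJoined N r A B) (h' : ConfJoined N r B C) : ConfJoined N r A C :=
  fun U hU => (h U hU).trans (h' U hU)

theorem mul_right (h : ConfJoined N r A B) (C : E3 ≃ₗᵢ[ℝ] E3) :
    ConfJoined N r (A * C) (B * C) :=
  fun _ hU => h _ (rotateConf_mem_confRadius hU)

theorem mul_left (h : ConfJoined N r A B) (C : E3 ≃ₗᵢ[ℝ] E3) :
    ConfJoined N r (C * A) (C * B) := by
  intro U hU
  obtain ⟨γ, hγ⟩ := h U hU
  exact ⟨γ.map (continuous_rotateConf C), fun t => rotateConf_mem_confRadius (hγ t)⟩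

end ConfJoined

theorem confJoined_reflection {N : ℕ} {r : ℝ} {v w : E3} (hv : v ≠ 0) (hw : w ≠ 0) :
    ConfJoined N r (Submodule.reflection (ℝ ∙ v)ᗮ) (Submodule.reflection (ℝ ∙ w)ᗮ) := by
  intro U hU
  have hrank : 1 < Module.rank ℝ E3 := by
    rw [← Module.finrank_eq_rank, finrank_euclideanSpace_fin]; norm_num
  obtain ⟨γ, hγ⟩ := (isPathConnected_compl_singleton_of_one_lt_rank hrank (0 : E3)).joinedIn
    v hv w hw
  have hcont (x : E3) : Continuous fun t => Submodule.reflection (ℝ ∙ γ t)ᗮ x := by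
    simp only [Submodule.reflection_orthogonal_apply, Submodule.reflection_singleton_apply]
    have h : Continuous fun t => inner ℝ (γ t) x / (‖γ t‖ : ℝ) ^ 2 :=
      (γ.continuous.inner continuous_const).div (by fun_prop)
        fun t => pow_ne_zero 2 (norm_ne_zero_iff.2 (hγ t))
    exact (((h.smul γ.continuous).const_smul 2).sub continuous_const).neg
  refine ⟨⟨⟨fun t => rotateConf (Submodule.reflection (ℝ ∙ γ t)ᗮ) U, ?_⟩, ?_, ?_⟩, fun t => ?_⟩
  · exact continuous_pi fun i => Continuous.subtype_mk (hcont (U i : E3)) _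
  · simp
  · simp
  · exact rotateConf_mem_confRadius hU

theorem det_mul_isometry (A B : E3 ≃ₗᵢ[ℝ] E3) :
    LinearMap.det ((A * B).toLinearEquiv : E3 →ₗ[ℝ] E3) =
      LinearMap.det (A.toLinearEquiv : E3 →ₗ[ℝ] E3) *
        LinearMap.det (B.toLinearEquiv : E3 →ₗ[ℝ] E3) := by
  rw [← map_mul]; rfl

theorem det_reflection_singleton {v : E3} (hv : v ≠ 0) :
    LinearMap.det ((Submodule.reflection (ℝ ∙ v)ᗮ).toLinearEquiv : E3 →ₗ[ℝ] E3) = -1 := by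
  have h := Submodule.det_reflection (ℝ ∙ v)ᗮ
  rw [Submodule.orthogonal_orthogonal, finrank_span_singleton hv, pow_one] at h
  exact h

/-- Up to paths, a product of reflections is the identity or one fixed reflection. -/
theorem confJoined_prod_reflections {N : ℕ} {r : ℝ} {e : E3} (he : e ≠ 0) (l : List E3) :
    let A : E3 ≃ₗᵢ[ℝ] E3 := (l.map fun v => Submodule.reflection (ℝ ∙ v)ᗮ).prod
    (LinearMap.det (A.toLinearEquiv : E3 →ₗ[ℝ] E3) = 1 ∧ ConfJoined N r A 1) ∨
      (LinearMap.det (A.toLinearEquiv : E3 →ₗ[ℝ] E3) = -1 ∧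
        ConfJoined N r A (Submodule.reflection (ℝ ∙ e)ᗮ)) := by
  induction l with
  | nil => exact Or.inl ⟨LinearMap.det_id, ConfJoined.refl 1⟩
  | cons v l ih =>
    simp only [List.map_cons, List.prod_cons] at ih ⊢
    rw [det_mul_isometry]
    rcases eq_or_ne v 0 with rfl | hv
    · have h1 : Submodule.reflection (ℝ ∙ (0 : E3))ᗮ = 1 := by
        ext1 x
        rw [Submodule.reflection_orthogonal_apply, Submodule.reflection_singleton_apply]
        simp
      rw [h1, one_mul]
      have hd : LinearMap.det ((1 : E3 ≃ₗᵢ[ℝ] E3).toLinearEquiv : E3 →ₗ[ℝ] E3) = 1 :=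
        LinearMap.det_id
      rwa [hd, one_mul]
    · rw [det_reflection_singleton hv]
      have hj := (confJoined_reflection (N := N) (r := r) hv he).mul_right
        (l.map fun v => Submodule.reflection (ℝ ∙ v)ᗮ).prod
      rcases ih with ⟨hd, h⟩ | ⟨hd, h⟩
      · refine Or.inr ⟨by rw [hd, mul_one], hj.trans ?_⟩
        simpa using h.mul_left (Submodule.reflection (ℝ ∙ e)ᗮ)
      · refine Or.inl ⟨by rw [hd]; norm_num, hj.trans ?_⟩
        simpa using h.mul_left (Submodule.reflection (ℝ ∙ e)ᗮ)

/-- A configuration can be moved to each of its rotated copies. -/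
theorem joinedIn_rotateConf {N : ℕ} {r : ℝ} {R : E3 ≃ₗᵢ[ℝ] E3} (hR : IsRotation R)
    {U : Fin N → S2} (hU : U ∈ confRadius N r) :
    JoinedIn (confRadius N r) U (rotateConf R U) := by
  obtain ⟨l, -, rfl⟩ := R.reflections_generate_dim
  have he : EuclideanSpace.single (0 : Fin 3) (1 : ℝ) ≠ 0 := by simp
  rcases confJoined_prod_reflections (N := N) (r := r) he l with ⟨-, h⟩ | ⟨hd, -⟩
  · exact (h U hU).symm
  · rw [IsRotation, hd] at hR
    norm_num at hR

/-! ### Compositions of moves -/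

theorem rigidM5_zero (r : ℝ) : rigidM5 r 0 = dod := by
  rw [← place_rigidParam, rigidParam_zero, place_regularParam, dod]

theorem rigidM5_one (r : ℝ) : rigidM5 r 1 = dod ∘ ringShift := by
  rw [← place_rigidParam, rigidParam_one, place_regularParam, rings_turn, dod]

theorem dod_injective : Function.Injective dod := by
  rw [dod_eq_place]
  have := arctan_two_mem
  exact place_mem_conf (regularParam_mem_admissible (by linarith [this.1, Real.pi_pos]) this.2)

theorem IsModifiedM5.apply_zero {r : ℝ} {R : E3 ≃ₗᵢ[ℝ] E3} {π : Equiv.Perm (Fin 12)}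
    {γ : unitInterval → Fin 12 → S2} (h : IsModifiedM5 r R π γ) :
    γ 0 = rotateConf R (dod ∘ π) := by
  rw [h.2.2.1 0 (Or.inl (by norm_num)), Set.Icc.coe_zero, rigidM5_zero]

theorem IsModifiedM5.apply_one {r : ℝ} {R : E3 ≃ₗᵢ[ℝ] E3} {π : Equiv.Perm (Fin 12)}
    {γ : unitInterval → Fin 12 → S2} (h : IsModifiedM5 r R π γ) :
    γ 1 = rotateConf R (dod ∘ (ringShift * π : Equiv.Perm (Fin 12))) := by
  rw [h.2.2.1 1 (Or.inr (by norm_num)), Set.Icc.coe_one, rigidM5_one]; rfl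

theorem M5Step.exists_even {r : ℝ} {X Y : Fin 12 → S2} (h : M5Step r X Y) :
    ∃ τ ∈ alternatingGroup (Fin 12), Y = X ∘ τ := by
  obtain ⟨R, π, γ, -, hγ, rfl, rfl⟩ := h
  refine ⟨π⁻¹ * ringShift * π, ?_, ?_⟩
  · rw [Equiv.Perm.mem_alternatingGroup]
    simp [sign_ringShift]
  · rw [hγ.apply_zero, hγ.apply_one]
    funext i
    simp [rotateConf]

theorem exists_even_of_reflTransGen {r : ℝ} {X Y : Fin 12 → S2}
    (h : Relation.ReflTransGen (M5Step r) X Y) :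
    ∃ τ ∈ alternatingGroup (Fin 12), Y = X ∘ τ := by
  induction h with
  | refl => exact ⟨1, one_mem _, rfl⟩
  | tail _ hstep ih =>
    obtain ⟨τ, hτ, rfl⟩ := ih
    obtain ⟨τ', hτ', rfl⟩ := hstep.exists_even
    exact ⟨τ * τ', mul_mem hτ hτ', rfl⟩

theorem joinedIn_of_reflTransGen {r : ℝ} {X Y : Fin 12 → S2} (hX : X ∈ confRadius 12 r)
    (h : Relation.ReflTransGen (M5Step r) X Y) : JoinedIn (confRadius 12 r) X Y := by
  induction h with
  | refl => exact JoinedIn.refl hX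
  | tail _ hstep ih =>
    obtain ⟨R, π, γ, -, hγ, rfl, rfl⟩ := hstep
    exact ih.trans ⟨⟨⟨γ, hγ.1⟩, rfl, rfl⟩, hγ.2.1⟩

/-- The relabellings, in terms of the vertices of the standard configuration, that are realized
by compositions of modified moves in every frame. -/
def realizedSubgroup (r : ℝ) : Subgroup (Equiv.Perm (Fin 12)) where
  carrier := {τ | ∀ (R : E3 ≃ₗᵢ[ℝ] E3) (π : Equiv.Perm (Fin 12)), IsRotation R →
    Relation.ReflTransGen (M5Step r) (rotateConf R (dod ∘ π))
      (rotateConf R (dod ∘ (τ * π : Equiv.Perm (Fin 12))))}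
  one_mem' := fun _ _ _ => Relation.ReflTransGen.refl
  mul_mem' := fun {a b} ha hb R π hR => (hb R π hR).trans (ha R (b * π) hR)
  inv_mem' := by
    intro τ hτ R π hR
    have hpow (n : ℕ) : Relation.ReflTransGen (M5Step r) (rotateConf R (dod ∘ π))
        (rotateConf R (dod ∘ (τ ^ n * π : Equiv.Perm (Fin 12)))) := by
      induction n with
      | zero => exact Relation.ReflTransGen.refl
      | succ n ih =>
        rw [pow_succ', mul_assoc]
        exact ih.trans (hτ R _ hR)
    have h : τ⁻¹ = τ ^ (orderOf τ - 1) := by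
      rw [inv_eq_iff_mul_eq_one, mul_pow_sub_one (orderOf_pos τ).ne', pow_orderOf_eq_one]
    rw [h]
    exact hpow _

/-- A rotational symmetry of the icosahedron amounts to a change of frame, and conjugates realized
relabellings into realized ones. -/
theorem conj_mem_realizedSubgroup {r : ℝ} {G : E3 ≃ₗᵢ[ℝ] E3} (hG : IsRotation G)
    {g : Equiv.Perm (Fin 12)} (hg : rotateConf G dod = dod ∘ g) {τ : Equiv.Perm (Fin 12)}
    (hτ : τ ∈ realizedSubgroup r) : g⁻¹ * τ * g ∈ realizedSubgroup r := by
  intro R π hR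
  have hframe (π : Equiv.Perm (Fin 12)) :
      rotateConf (G.symm.trans R) (dod ∘ (g * π : Equiv.Perm (Fin 12))) =
        rotateConf R (dod ∘ π) := by
    rw [Equiv.Perm.coe_mul, ← Function.comp_assoc, ← hg]
    funext i
    simp [rotateConf]
  have h := hτ (G.symm.trans R) (g * π) (isRotation_trans (isRotation_symm hG) hR)
  rw [hframe, show τ * (g * π) = g * (g⁻¹ * τ * g * π) by group, hframe] at h
  exact h

theorem alternatingGroup_le_realizedSubgroup {r : ℝ}
    (h : ∀ (R : E3 ≃ₗᵢ[ℝ] E3) (π : Equiv.Perm (Fin 12)),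
      ∃ γ : unitInterval → Fin 12 → S2, IsModifiedM5 r R π γ) :
    alternatingGroup (Fin 12) ≤ realizedSubgroup r := by
  obtain ⟨G, hG, hGd⟩ := exists_rotation_halfTurn
  obtain ⟨G', hG', hGd'⟩ := exists_rotation_axialTurn
  refine alternatingGroup_le_of_ringShift_mem (fun R π hR => ?_)
    (fun x hx => conj_mem_realizedSubgroup hG hGd hx)
    (fun x hx => conj_mem_realizedSubgroup hG' hGd' hx)
  obtain ⟨γ, hγ⟩ := h R π
  exact Relation.ReflTransGen.single ⟨R, π, γ, hR, hγ, hγ.apply_zero, hγ.apply_one⟩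

theorem reflTransGen_comp_iff {r : ℝ}
    (h : ∀ (R : E3 ≃ₗᵢ[ℝ] E3) (π : Equiv.Perm (Fin 12)),
      ∃ γ : unitInterval → Fin 12 → S2, IsModifiedM5 r R π γ)
    {X : Fin 12 → S2} (hX : IsDOD X) (σ : Equiv.Perm (Fin 12)) :
    Relation.ReflTransGen (M5Step r) X (X ∘ σ) ↔ σ ∈ alternatingGroup (Fin 12) := by
  obtain ⟨R, π, hR, rfl⟩ := hX
  constructor
  · intro hσ
    obtain ⟨τ, hτ, heq⟩ := exists_even_of_reflTransGen hσ
    have hinj : Function.Injective (rotateConf R (dod ∘ π)) :=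
      rotateConf_mem_conf (dod_injective.comp π.injective)
    have : σ = τ := Equiv.ext fun i => hinj (congrFun heq i)
    rwa [this]
  · intro hσ
    have hmem : π * σ * π⁻¹ ∈ alternatingGroup (Fin 12) := by
      rw [Equiv.Perm.mem_alternatingGroup] at hσ ⊢
      simp [hσ]
    have := alternatingGroup_le_realizedSubgroup h hmem R π hR
    rwa [inv_mul_cancel_right] at this

theorem IsDOD.mem_confRadius {r : ℝ} (hr : 0 < r) (h : contactAngle r ≤ Real.arctan 2)
    {X : Fin 12 → S2} (hX : IsDOD X) : X ∈ confRadius 12 r := by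
  obtain ⟨R, π, -, rfl⟩ := hX
  refine rotateConf_mem_confRadius (comp_perm_mem_confRadius ?_ π)
  simpa [dod] using staggered_rings_mem_confRadius hr h le_rfl 0

theorem theorem6p2 :
    ∃ r₁ : ℝ, 1 < r₁ ∧ ∀ r : ℝ, 0 < r → r ≤ r₁ →
      -- every `M₅`-move can be modified so that it can be performed with balls of radius `r`
      (∀ (R : E3 ≃ₗᵢ[ℝ] E3) (π : Equiv.Perm (Fin 12)), IsRotation R →
        ∃ γ : unitInterval → Fin 12 → S2, IsModifiedM5 r R π γ) ∧
      -- the relabellings realized by compositions of modified moves form the alternating group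
      (∀ X : Fin 12 → S2, IsDOD X → ∀ σ : Equiv.Perm (Fin 12),
        Relation.ReflTransGen (M5Step r) X (X ∘ σ) ↔ σ ∈ alternatingGroup (Fin 12)) ∧
      -- every evenly relabelled `DOD` configuration is reached inside `Conf(12)[r]`
      (∀ X : Fin 12 → S2, IsDOD X → ∀ σ ∈ alternatingGroup (Fin 12),
        ∀ R : E3 ≃ₗᵢ[ℝ] E3, IsRotation R →
          JoinedIn (confRadius 12 r) X (rotateConf R (X ∘ σ))) := by
  obtain ⟨r₁, hr₁, h⟩ := exists_radius
  refine ⟨r₁, hr₁, fun r hr hr' => ?_⟩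
  obtain ⟨hθ, hj⟩ := h r hr hr'
  have hmove := exists_isModifiedM5 hr hθ.le hj
  refine ⟨fun R π _ => hmove R π, fun X hX σ => reflTransGen_comp_iff hmove hX σ,
    fun X hX σ hσ R hR => ?_⟩
  have hXr := hX.mem_confRadius hr hθ.le
  exact (joinedIn_of_reflTransGen hXr ((reflTransGen_comp_iff hmove hX σ).2 hσ)).trans
    (joinedIn_rotateConf hR (comp_perm_mem_confRadius hXr σ))
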